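/- Let $k,l$ be positive integers and $n=k+l$. Let $\sigma_0=1$ and $\sigma_i=0$ for $i<0$ or $i>k$, put $Y_p=\det(\sigma_{1+j-i})_{1\le i,j\le p}$, and let $$\Lambda(l,k)=\mathbf Z[q,\sigma_1,\dots,\sigma_k]/\bigl(Y_{l+1},\dots,Y_{n-1},\,Y_n+(-1)^kq\bigr).$$ For a partition $\lambda=(\lambda_1,\dots,\lambda_s)$ let $\sigma_\lambda\in\Lambda(l,k)$ be the class of $\det(\sigma_{\lambda_i+j-i})_{1\le i,j\le s}$; $(1^p)$ is the partition with $p$ parts equal to $1$, $\widetilde\lambda$ is the conjugate partition of $\lambda$, and $\lambda\subset l\times k$ means that $\lambda$ has at most $l$ rows, each of length at most $k$. For $\nu\subset l\times k$ and $m\ge 0$ let $\nu[m]$ be the partition obtained from $\nu$ by adding $m$ rim hooks with $n$ boxes, each starting in the first column and ending in the $k$-th column. A tableau (respectively, conjugate tableau) on a skew shape $\varrho/\lambda$ is a filling of its boxes that is weakly increasing across rows and strictly increasing down columns (respectively, strictly increasing across rows and weakly increasing down columns). It has content $\mu=(\mu_1,\dots,\mu_r)$ if its entries are $\mu_1$ $1$'s,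 $\dots$, $\mu_r$ $r$'s. It is proper (with respect to $l$ and $k$) if, for each entry $i$ in the first column and row $l+p$, $p\ge 1$, the box in the $k$-th column and row $p$ is either in $\lambda$, or is in $\varrho/\lambda$ and has an entry at most equal to $i$ (respectively, strictly smaller than $i$). For a sequence $\mu=(\mu_1,\dots,\mu_r)$ of nonnegative integers, $\lambda,\nu\subset l\times k$ and $m\ge 0$ with $|\lambda|+\sum\mu_i=|\nu|+mn$, let $K_{\lambda\mu}^{\nu}(l,k)$ (respectively, $\widetilde K_{\lambda\mu}^{\nu}(l,k)$) be the number of proper tableaux (respectively, proper conjugate tableaux) of content $\mu$ on $\nu[m]/\lambda$; it is $0$ if $\lambda\not\subset\nu[m]$. **Proposition 4.3.** (1) For $\lambda\subset l\times k$ and integers $0\le\mu_1,\dots,\mu_r\le l$ (in any order), one has in $\Lambda(l,k)$ $$\sigma_{(1^{\mu_r})}\cdots\sigma_{(1^{\mu_1})}\cdot\sigma_\lambda=\sum\widetilde K_{\lambda\mu}^{\nu}(l,k)\,q^m\sigma_\nu,$$ the sum over all $\nu\subset l\times k$ and $m\ge 0$ with $|\nu|+mn=|\lambda|+\sum\mu_i$.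 (2) For $\lambda,\nu\subset l\times k$, integers $0\le\mu_1,\dots,\mu_r\le k$ (in any order) and $m\ge 0$ with $|\lambda|+\sum\mu_i=|\nu|+mn$, $$K_{\lambda\mu}^{\nu}(l,k)=\widetilde K_{\widetilde\lambda\mu}^{\widetilde\nu}(k,l).$$ -/

import Mathlib

noncomputable section

namespace QSchur

/-! ### The ring `Λ(l,k) = ℤ[q,σ₁,…,σₖ] / (Y_{l+1}, …, Y_{n-1}, Y_n + (-1)^k q)`, `n = k + l` -/

/-- The polynomial ring `ℤ[q][σ₁,…,σₖ]`; the variable with index `i : Fin k` is `σ_{i+1}`. -/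
abbrev PolyRing (k : ℕ) : Type := MvPolynomial (Fin k) (Polynomial ℤ)

/-- `σ_i` for an arbitrary integer `i`: the variable if `1 ≤ i ≤ k`, with `σ₀ = 1` and
`σ_i = 0` for `i < 0` and for `i > k`. -/
def sigmaPoly (k : ℕ) (i : ℤ) : PolyRing k :=
  if h : 1 ≤ i ∧ i ≤ k then MvPolynomial.X ⟨(i - 1).toNat, by omega⟩
  else if i = 0 then 1 else 0

/-- `Y_p = det (σ_{1+j-i})_{1 ≤ i,j ≤ p}`. -/
def Y (k p : ℕ) : PolyRing k :=
  (Matrix.of fun i j : Fin p => sigmaPoly k (1 + (j : ℤ) - (i : ℤ))).det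

/-- The variable `q`, in the polynomial ring. -/
def qPoly (k : ℕ) : PolyRing k := MvPolynomial.C Polynomial.X

/-- The ideal `(Y_{l+1}, …, Y_{n-1}, Y_n + (-1)^k q)`, with `n = k + l`. -/
def relIdeal (l k : ℕ) : Ideal (PolyRing k) :=
  Ideal.span ({f | ∃ p : ℕ, l < p ∧ p < k + l ∧ f = Y k p} ∪
    {Y k (k + l) + (-1) ^ k * qPoly k})

/-- The ring `Λ(l,k)`. -/
abbrev Lam (l k : ℕ) : Type := PolyRing k ⧸ relIdeal l k

/-- The element `q` of `Λ(l,k)`. -/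
def q (l k : ℕ) : Lam l k := Ideal.Quotient.mk (relIdeal l k) (qPoly k)

/-- For a partition `lam = (λ₁,…,λ_r)`, the element `σ_λ` of `Λ(l,k)`, the image of
`det (σ_{λ_i+j-i})_{1 ≤ i,j ≤ r}`. A partition is identified with its Young diagram:
`lam.rowLen i` is `λ_{i+1}` and `lam.colLen 0` is the number of (nonzero) parts. -/
def sigma (l k : ℕ) (lam : YoungDiagram) : Lam l k :=
  Ideal.Quotient.mk (relIdeal l k)
    (Matrix.of fun i j : Fin (lam.colLen 0) =>
      sigmaPoly k ((lam.rowLen i : ℤ) + (j : ℤ) - (i : ℤ))).det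

/-! ### Partitions in a rectangle -/

/-- `λ ⊂ l × k`: at most `l` rows, each of length at most `k`. -/
def InRect (l k : ℕ) (lam : YoungDiagram) : Prop := lam.colLen 0 ≤ l ∧ lam.rowLen 0 ≤ k

/-- The partition `(1^p)`: a single column of `p` boxes. -/
def column (p : ℕ) : YoungDiagram where
  cells := Finset.range p ×ˢ Finset.range 1
  isLowerSet := by
    rintro ⟨a, b⟩ ⟨c, d⟩ ⟨h1, h2⟩ h
    simp only [Finset.coe_product, Finset.coe_range, Set.mem_prod, Set.mem_Iio] at h ⊢
    simp only at h1 h2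
    omega

theorem finite_inRect (l k : ℕ) : {lam : YoungDiagram | InRect l k lam}.Finite := by
  refine Set.Finite.of_finite_image (f := YoungDiagram.cells)
    (Set.Finite.subset (Finset.range l ×ˢ Finset.range k).powerset.finite_toSet ?_) ?_
  · rintro _ ⟨lam, ⟨h1, h2⟩, rfl⟩
    simp only [Finset.mem_coe, Finset.mem_powerset]
    rintro ⟨i, j⟩ hc
    rw [YoungDiagram.mem_cells] at hc
    have hi := YoungDiagram.mem_iff_lt_colLen.1 (lam.up_left_mem le_rfl (Nat.zero_le j) hc)
    have hj := YoungDiagram.mem_iff_lt_rowLen.1 (lam.up_left_mem (Nat.zero_le i) le_rfl hc)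
    simp only [Finset.mem_product, Finset.mem_range]
    omega
  · intro a _ b _ h
    exact YoungDiagram.ext h

/-- The finite set of all partitions `ν ⊂ l × k`. -/
def rectPartitions (l k : ℕ) : Finset YoungDiagram := (finite_inRect l k).toFinset

/-! ### The partitions `ν[m]`

Boxes are written `(row, column)` and counted from `0`, so the first column is column `0` and the
`k`-th column is column `k - 1`. -/

/-- The partition obtained from `ν` by adding a rim hook with `l + k` boxes which starts in the
first column and ends in the `k`-th column. The boxes along the outer border of `ν` are those
`(i, j) ∉ ν` with `i = 0`, or `j = 0`, or `(i - 1, j - 1) ∈ ν`. The hook consists of the border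
boxes in the first `k` columns, from the first free box of the `k`-th column (row
`ν.colLen (k - 1)`) down to the box in the first column that is `l` rows below it. -/
def addRim (l k : ℕ) (nu : YoungDiagram) : YoungDiagram where
  cells := (Finset.range (nu.colLen (k - 1) + l + 1) ×ˢ Finset.range k).filter
    fun c => c.1 = 0 ∨ c.2 = 0 ∨ (c.1 - 1, c.2 - 1) ∈ nu
  isLowerSet := by
    rintro ⟨a, b⟩ ⟨c, d⟩ ⟨h1, h2⟩ h
    simp only [Finset.coe_filter, Finset.mem_product, Finset.mem_range, Set.mem_ofPred_eq] at h ⊢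
    simp only at h1 h2
    obtain ⟨⟨ha, hb⟩, h⟩ := h
    refine ⟨⟨by omega, by omega⟩, ?_⟩
    rcases h with h | h | h
    · left; omega
    · right; left; omega
    · right; right
      exact nu.up_left_mem (by omega) (by omega) h

theorem mem_addRim {l k : ℕ} {nu : YoungDiagram} {i j : ℕ} :
    (i, j) ∈ addRim l k nu ↔ (i ≤ nu.colLen (k - 1) + l ∧ j < k) ∧
      (i = 0 ∨ j = 0 ∨ (i - 1, j - 1) ∈ nu) := by
  rw [← YoungDiagram.mem_cells]
  simp [addRim]

/-- The new first column has `l + 1` boxes more than the old `k`-th column. -/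
theorem colLen_addRim_zero {l k : ℕ} (hk : 0 < k) (nu : YoungDiagram) :
    (addRim l k nu).colLen 0 = nu.colLen (k - 1) + l + 1 := by
  refine eq_of_forall_lt_iff fun i => ?_
  rw [← YoungDiagram.mem_iff_lt_colLen, mem_addRim]
  simp [hk]

/-- Every other one of the first `k` columns of the new diagram has one box more than the column
of the old diagram to the left of it. -/
theorem colLen_addRim_succ {l k : ℕ} {nu : YoungDiagram}
    (h : nu.colLen 0 ≤ nu.colLen (k - 1) + l) {j : ℕ} (hj : j + 1 < k) :
    (addRim l k nu).colLen (j + 1) = nu.colLen j + 1 := by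
  refine eq_of_forall_lt_iff fun i => ?_
  have h2 : nu.colLen j ≤ nu.colLen 0 := nu.colLen_anti 0 j (Nat.zero_le j)
  rw [← YoungDiagram.mem_iff_lt_colLen, mem_addRim]
  simp only [Nat.add_sub_cancel, YoungDiagram.mem_iff_lt_colLen]
  omega

/-- `ν[m]`: the partition obtained from `ν` by adding `m` rim `n`-hooks, `n = k + l`, each starting
in the first column and ending in the `k`-th column. -/
def addRims (l k : ℕ) (nu : YoungDiagram) (m : ℕ) : YoungDiagram := (addRim l k)^[m] nu

/-! ### Tableaux on a skew shape `ϱ/λ` -/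

/-- A numbering, with numbers from an `r`-element set `1 < 2 < ⋯ < r`, of the boxes of `ϱ/λ`, the
complement of the diagram of `λ` in the diagram of `ϱ`. -/
abbrev Filling (rho lam : YoungDiagram) (r : ℕ) : Type :=
  {c : ℕ × ℕ // c ∈ rho.cells \ lam.cells} → Fin r

variable {rho lam : YoungDiagram} {r : ℕ}

/-- The filling has content `μ = (μ₁,…,μ_r)`: the `i`-th number occurs `μ_i` times. -/
def HasContent (T : Filling rho lam r) (mu : Fin r → ℕ) : Prop :=
  ∀ i, Nat.card {c // T c = i} = mu i

/-- A (semistandard) tableau: weakly increasing across rows, strictly increasing down columns. -/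
def IsTableau (T : Filling rho lam r) : Prop :=
  (∀ c d, c.1.1 = d.1.1 → c.1.2 < d.1.2 → T c ≤ T d) ∧
  (∀ c d, c.1.2 = d.1.2 → c.1.1 < d.1.1 → T c < T d)

/-- A conjugate tableau: strictly increasing across rows, weakly increasing down columns. -/
def IsConjTableau (T : Filling rho lam r) : Prop :=
  (∀ c d, c.1.1 = d.1.1 → c.1.2 < d.1.2 → T c < T d) ∧
  (∀ c d, c.1.2 = d.1.2 → c.1.1 < d.1.1 → T c ≤ T d)

/-- A tableau is proper if for each of its entries in the first column and in row `l + p + 1`, the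
box in the `k`-th column and row `p + 1` (rows are counted from `1` here) is either in `λ`, or is in
`ϱ/λ` and has an entry at most equal to the given one. -/
def IsProper (l k : ℕ) (T : Filling rho lam r) : Prop :=
  ∀ c, c.1.2 = 0 → ∀ p, c.1.1 = l + p →
    (p, k - 1) ∈ lam ∨ ∃ d, d.1 = (p, k - 1) ∧ T d ≤ T c

/-- A conjugate tableau is proper if for each of its entries in the first column and in row
`l + p + 1`, the box in the `k`-th column and row `p + 1` (rows are counted from `1` here) is either
in `λ`, or is in `ϱ/λ` and has an entry strictly smaller than the given one. -/
def IsConjProper (l k : ℕ) (T : Filling rho lam r) : Prop :=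
  ∀ c, c.1.2 = 0 → ∀ p, c.1.1 = l + p →
    (p, k - 1) ∈ lam ∨ ∃ d, d.1 = (p, k - 1) ∧ T d < T c

/-- The quantum Kostka number `K^ν_{λμ}(l,k)`: the number of proper tableaux on `ν[m]/λ` with
content `μ`. It is used for `λ, ν ⊂ l × k` with `|λ| + ∑ μ_i = |ν| + m (k + l)` only, and this
equation determines `m`. There are none if `ν[m]` does not contain `λ`. -/
def quantumKostka (l k : ℕ) (lam : YoungDiagram) {r : ℕ} (mu : Fin r → ℕ)
    (nu : YoungDiagram) (m : ℕ) : ℕ :=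
  Nat.card {T : Filling (addRims l k nu m) lam r //
    lam ≤ addRims l k nu m ∧ HasContent T mu ∧ IsTableau T ∧ IsProper l k T}

/-- The conjugate quantum Kostka number: the number of proper conjugate tableaux on `ν[m]/λ` with
content `μ`, where again `|λ| + ∑ μ_i = |ν| + m (k + l)`. -/
def conjQuantumKostka (l k : ℕ) (lam : YoungDiagram) {r : ℕ} (mu : Fin r → ℕ)
    (nu : YoungDiagram) (m : ℕ) : ℕ :=
  Nat.card {T : Filling (addRims l k nu m) lam r //
    lam ≤ addRims l k nu m ∧ HasContent T mu ∧ IsConjTableau T ∧ IsConjProper l k T}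

/-- The finite set of pairs `(ν, m)` with `ν ⊂ l × k`, `m ≥ 0` and `|ν| + m (k + l) = N`
(the bound `m ≤ N` follows from the equation if `k + l > 0`). -/
def termIndex (l k N : ℕ) : Finset (YoungDiagram × ℕ) :=
  (rectPartitions l k ×ˢ Finset.range (N + 1)).filter fun x => x.1.card + x.2 * (k + l) = N

end QSchur

end

noncomputable section

namespace QSchur

open Polynomial

/-! The relations of $\Lambda(l,k)$ say that the $\sigma_p$ obey a linear recurrence of order $l$
with coefficients $\pm Y_1,\dots,\pm Y_l$. The relation for $Y_n$ is exactly what lets the values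
$\sigma_p$, $p<n$, continue to a sequence with $h_{p+n}=(-1)^{l+1}q\,h_p$ without breaking this
recurrence (`hPer`, `hPer_rec`).

For such a sequence, shifting the rows of $R=(h_{a_i+j-i})$ by one is right multiplication by a
companion matrix $N$. Hence $\det R\cdot\det(1+XN)=\det(R+XR')$ with $R'=RN$ the shifted matrix.
Expanding by rows, the coefficient of $X^p$ in $\det(1+XN)$ acts by adding $1$ to $p$ of the $l$
indices $a_i$ in all ways; the case $a=0$ identifies this coefficient with $\sigma_{(1^p)}$
(`coeff_det_mul_jt`, `sigma_column_mul_jt`). A summand whose indices do not form a cylindric diagram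
vanishes: two adjacent rows coincide, or the first row is a multiple of the last by
quasi-periodicity. For the others, a rim $n$-hook rotates the rows and contributes a factor $q$
(`jt_colLen_addRim`). This is the quantum Pieri rule, with no cancellation left.

On the combinatorial side, the boxes with the largest entry form a strip, and properness is the
wrap-around condition making it a strip on the cylinder. Removing them gives the recursion
`count_succ`, which is also what multiplication by one more $\sigma_{(1^p)}$ produces; this proves
(1). For (2), both numbers obey this recursion, and transposition exchanges the two kinds of
cylindric strips (`step_false_iff_step_true`). -/

/-- The determinant `det (h_{a_i + j - i})` of size `l`. -/
def jt {A : Type*} [CommRing A] (h : ℤ → A) {l : ℕ} (a : Fin l → ℤ) : A :=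
  (Matrix.of fun i j : Fin l => h (a i + (j : ℤ) - (i : ℤ))).det

/-! ### Jacobi–Trudi determinants of recurrent and quasi-periodic sequences. -/

section JacobiTrudi
variable {A : Type*} [CommRing A] {h : ℤ → A} {l : ℕ}

theorem coeff_det_mul_jt (N : Matrix (Fin l) (Fin l) A)
    (hN : ∀ d : ℤ, -(l : ℤ) < d → ∀ j : Fin l, ∑ i : Fin l, h (d + i) * N i j = h (d + 1 + j))
    (a : Fin l → ℤ) (ha : ∀ i, 0 ≤ a i) (p : ℕ) :
    (Matrix.det (1 + (X : A[X]) • N.map C)).coeff p * jt h a =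
      ∑ S ∈ Finset.powersetCard p Finset.univ, jt h fun i => a i + if i ∈ S then 1 else 0 := by
  set R : Matrix (Fin l) (Fin l) A := Matrix.of fun i j => h (a i + (j : ℤ) - (i : ℤ)) with hR
  set R' : Matrix (Fin l) (Fin l) A := Matrix.of fun i j => h (a i + 1 + (j : ℤ) - (i : ℤ)) with hR'
  have hRN : R * N = R' := by
    ext i j
    have := hN (a i - i) (by have := ha i; have := i.2; omega) j
    simp only [Matrix.mul_apply, hR, hR', Matrix.of_apply]
    rw [show a i + 1 + (j : ℤ) - (i : ℤ) = a i - i + 1 + j by ring, ← this]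
    exact Finset.sum_congr rfl fun x _ => by rw [show a i + (x : ℤ) - i = a i - i + x by ring]
  have key : R.map C * (1 + (X : A[X]) • N.map C) = R.map C + (X : A[X]) • R'.map C := by
    rw [mul_add, mul_one, Matrix.mul_smul, ← hRN, Matrix.map_mul]
  have h1 : Matrix.det (R.map C + (X : A[X]) • R'.map C) =
      ∑ S : Finset (Fin l), (X : A[X]) ^ S.card *
        C (jt h fun i => a i + if i ∈ S then 1 else 0) := by
    -- Multilinearity in the rows: `S` is the set of rows taken from the shifted matrix.
    have h2 := (Matrix.detRowAlternating (R := A[X]) (n := Fin l)).toMultilinearMap.map_add_univ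
      ((X : A[X]) • R'.map C) (R.map C)
    rw [add_comm]
    refine h2.trans (Finset.sum_congr rfl fun S _ => ?_)
    have h3 : S.piecewise ((X : A[X]) • R'.map C) (R.map C) =
        Matrix.of fun i j => (if i ∈ S then (X : A[X]) else 1) *
          (Matrix.of fun i j : Fin l =>
            C (h ((a i + if i ∈ S then 1 else 0) + (j : ℤ) - (i : ℤ)))) i j := by
      refine Matrix.ext fun i j => ?_
      by_cases hi : i ∈ S <;> simp [Finset.piecewise, hi, hR, hR']
    change Matrix.det (S.piecewise ((X : A[X]) • R'.map C) (R.map C)) = _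
    rw [h3, Matrix.det_mul_column, Finset.prod_ite_mem, Finset.univ_inter, Finset.prod_const, jt,
      RingHom.map_det]
    rfl
  have h4 : (Matrix.det (1 + (X : A[X]) • N.map C)) * C (jt h a) =
      ∑ S : Finset (Fin l), (X : A[X]) ^ S.card *
        C (jt h fun i => a i + if i ∈ S then 1 else 0) := by
    rw [← h1, ← key, Matrix.det_mul, mul_comm, jt, RingHom.map_det]
    rfl
  have h5 := congrArg (fun f => f.coeff p) h4
  simp only [coeff_mul_C, finsetSum_coeff, coeff_X_pow] at h5
  rw [h5, Finset.powersetCard_eq_filter, Finset.powerset_univ, Finset.sum_filter]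
  refine Finset.sum_congr rfl fun S _ => ?_
  simp [eq_comm]

/-- Kills the superfluous terms of the Pieri expansion: `c = 1` for adjacent equal rows, `c` the
period factor for the wrap-around from the last row to the first. -/
theorem jt_eq_zero_of_row_eq_mul {a : Fin l → ℤ} {i j : Fin l} (hij : i ≠ j) (c : A)
    (hr : ∀ x : Fin l, h (a i + x - i) = c * h (a j + x - j)) : jt h a = 0 := by
  set M : Matrix (Fin l) (Fin l) A := Matrix.of fun i j => h (a i + (j : ℤ) - (i : ℤ)) with hM
  have h1 : M = M.updateRow i (c • M j) := by
    ext x y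
    by_cases hx : x = i
    · subst hx
      simp [hM, hr]
    · simp [Matrix.updateRow_ne hx]
  change M.det = 0
  rw [h1, Matrix.det_updateRow_smul, Matrix.det_updateRow_eq_zero hij.symm, mul_zero]

/-- A companion matrix shifts the rows of a sequence which satisfies a linear recurrence. -/
theorem exists_companion (e : ℕ → A)
    (hrec : ∀ p : ℤ, 0 < p → h p = ∑ i : Fin l, e i * h (p - l + i)) :
    ∃ N : Matrix (Fin l) (Fin l) A, ∀ d : ℤ, -(l : ℤ) < d → ∀ j : Fin l,
      ∑ i : Fin l, h (d + i) * N i j = h (d + 1 + j) := by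
  -- All columns but the last shift the index by one; the last column applies the recurrence at `d +
  -- l`, which is positive because `d > -l`.
  refine ⟨Matrix.of fun i j => if (j : ℕ) + 1 = l then e i else if (i : ℕ) = j + 1 then 1 else 0,
    fun d hd j => ?_⟩
  simp only [Matrix.of_apply]
  by_cases hj : (j : ℕ) + 1 = l
  · simp only [hj, if_true]
    rw [hrec _ (by omega)]
    refine Finset.sum_congr rfl fun i _ => ?_
    rw [mul_comm, show d + 1 + (j : ℤ) - l + i = d + i by omega]
  · simp only [hj, if_false]
    rw [Finset.sum_eq_single (⟨j + 1, by omega⟩ : Fin l)]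
    · simp only [if_true, mul_one]
      congr 1; push_cast; ring
    · intro b _ hb
      rw [if_neg (fun hh => hb (Fin.ext hh)), mul_zero]
    · simp

/-- Rows beyond the last part do not change the determinant. -/
theorem det_eq_det_of_le (h0 : h 0 = 1) (hneg : ∀ p < 0, h p = 0) (a : ℕ → ℕ) {s t : ℕ}
    (hst : s ≤ t) (ha : ∀ i, s ≤ i → a i = 0) :
    (Matrix.of fun i j : Fin t => h ((a i : ℤ) + (j : ℤ) - (i : ℤ))).det =
      (Matrix.of fun i j : Fin s => h ((a i : ℤ) + (j : ℤ) - (i : ℤ))).det := by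
  induction t, hst using Nat.le_induction with
  | base => rfl
  | succ t hst ih =>
    rw [← ih, Matrix.det_succ_row _ (Fin.last t), Finset.sum_eq_single (Fin.last t)]
    · simp only [Matrix.of_apply, Fin.val_last, ha t hst]
      rw [show (((0 : ℕ) : ℤ) + (t : ℤ) - t) = 0 by simp, h0, ← two_mul, pow_mul]
      simp only [even_two, Even.neg_pow, one_pow, one_mul]
      congr 1
      refine Matrix.ext fun i j => ?_
      simp [Matrix.submatrix_apply, Fin.succAbove_last]
    · intro b _ hb
      have : (b : ℕ) < t := Fin.val_lt_last hb
      simp only [Matrix.of_apply, Fin.val_last, ha t hst]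
      rw [hneg _ (by push_cast; omega)]
      ring
    · simp

/-- If `h` is quasi-periodic, moving the last row to the top, shifted by a period, multiplies
the determinant by the period factor, up to sign. -/
theorem jt_cycle {m : ℕ} {c : A} {n : ℤ} (hper : ∀ p : ℤ, -((m : ℤ) + 1) < p → h (p + n) = c * h p)
    (a b : Fin (m + 1) → ℤ) (ha : ∀ i, 0 ≤ a i)
    (hb0 : b 0 = a (Fin.last m) - m + n) (hb : ∀ i : Fin m, b i.succ = a i.castSucc + 1) :
    jt h b = (-1) ^ m * c * jt h a := by
  set M : Matrix (Fin (m + 1)) (Fin (m + 1)) A :=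
    Matrix.of fun i j => h (a i + (j : ℤ) - (i : ℤ)) with hM
  have h1 : (Matrix.of fun i j : Fin (m + 1) => h (b i + (j : ℤ) - (i : ℤ))) =
      Matrix.of fun i j => (if i = 0 then c else 1) *
        (M.submatrix (finRotate (m + 1)).symm id) i j := by
    ext i j
    simp only [Matrix.of_apply, Matrix.submatrix_apply, id]
    refine Fin.cases ?_ (fun i => ?_) i
    · have e1 : (finRotate (m + 1)).symm 0 = Fin.last m := by
        rw [Equiv.symm_apply_eq]; simp
      rw [e1, if_pos rfl, hM, Matrix.of_apply, hb0, ← hper]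
      · congr 1; simp; ring
      · have := ha (Fin.last m); simp; omega
    · have e1 : (finRotate (m + 1)).symm i.succ = i.castSucc := by
        rw [Equiv.symm_apply_eq]; simp
      rw [e1, if_neg (Fin.succ_ne_zero i), one_mul, hM, Matrix.of_apply, hb]
      congr 1; simp; ring
  rw [jt, h1, Matrix.det_mul_column, Matrix.det_permute, Equiv.Perm.sign_symm, sign_finRotate,
    Finset.prod_ite_eq' Finset.univ (0 : Fin (m + 1)) (fun _ => c), jt]
  simp only [Finset.mem_univ, if_true]
  push_cast
  ring

end JacobiTrudi

/-! ### Duality between the $Y_p$ and the $\sigma_p$ in the polynomial ring. -/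

/-- Expansion of the determinant `Y` with a modified first row. -/
theorem det_first_row_eq_sum {k : ℕ} (p : ℕ) (u : ℕ → PolyRing k) :
    (Matrix.of fun i j : Fin p =>
      if (i : ℕ) = 0 then u j else sigmaPoly k (1 + (j : ℤ) - (i : ℤ))).det =
      if p = 0 then 1 else ∑ j ∈ Finset.range p, (-1) ^ j * u j * Y k (p - 1 - j) := by
  induction p generalizing u with
  | zero => simp
  | succ p ih =>
    rw [if_neg (Nat.succ_ne_zero p), Matrix.det_succ_column_zero, Fin.sum_univ_succ]
    have hY : ((Matrix.of fun i j : Fin (p + 1) => if (i : ℕ) = 0 then u j else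
        sigmaPoly k (1 + (j : ℤ) - (i : ℤ))).submatrix (Fin.succAbove 0) Fin.succ).det = Y k p := by
      rw [Y]
      congr 1
      refine Matrix.ext fun i j => ?_
      simp
      congr 1; ring
    rw [hY, Finset.sum_range_succ']
    have h0 : ∀ i : ℤ, i < 0 → sigmaPoly k i = 0 := fun i hi => by
      rw [sigmaPoly, dif_neg (by omega), if_neg (by omega)]
    cases p with
    | zero => simp
    | succ p =>
      -- The matrix is Hessenberg: column 0 has only `u 0` and $\sigma_0=1$ on top. Deleting row 1
      -- leaves a matrix of the same shape with `u` shifted, which is why the first row is kept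
      -- arbitrary in the induction.
      rw [Fin.sum_univ_succ, Finset.sum_eq_zero (s := (Finset.univ : Finset (Fin p)))]
      · have hm : ((Matrix.of fun i j : Fin (p + 2) => if (i : ℕ) = 0 then u j else
            sigmaPoly k (1 + (j : ℤ) - (i : ℤ))).submatrix (Fin.succAbove 1) Fin.succ).det =
            ∑ j ∈ Finset.range (p + 1), (-1) ^ j * u (j + 1) * Y k (p + 1 - 1 - j) := by
          have := ih (fun j => u (j + 1))
          rw [if_neg (Nat.succ_ne_zero p)] at this
          rw [← this]
          congr 1
          refine Matrix.ext fun i j => ?_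
          refine Fin.cases ?_ (fun i => ?_) i
          · simp
          · have : (Fin.succAbove (1 : Fin (p + 2)) i.succ) = i.succ.succ := by
              rw [Fin.succAbove_of_lt_succ]
              simp [Fin.lt_def]
            simp [this]
            congr 1; ring
        have hs : ∑ j ∈ Finset.range (p + 1), (-1) ^ (j + 1) * u (j + 1) *
            Y k (p + 1 + 1 - 1 - (j + 1)) =
            -∑ j ∈ Finset.range (p + 1), (-1) ^ j * u (j + 1) * Y k (p + 1 - 1 - j) := by
          rw [← Finset.sum_neg_distrib]
          refine Finset.sum_congr rfl fun j _ => ?_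
          rw [show p + 1 + 1 - 1 - (j + 1) = p + 1 - 1 - j by omega]
          ring
        rw [hs]
        simp only [Fin.succ_zero_eq_one, Matrix.of_apply, hm]
        generalize ∑ j ∈ Finset.range (p + 1), (-1) ^ j * u (j + 1) * Y k (p + 1 - 1 - j) = s
        simp [sigmaPoly]
        ring
      · intro i _
        rw [Matrix.of_apply, if_neg (by simp), h0 _ (by simp; omega)]
        simp

theorem Y_succ (k p : ℕ) :
    Y k (p + 1) = ∑ j ∈ Finset.range (p + 1), (-1) ^ j * sigmaPoly k (j + 1) * Y k (p - j) := by
  have := det_first_row_eq_sum (k := k) (p + 1) (fun j => sigmaPoly k (j + 1))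
  rw [if_neg (Nat.succ_ne_zero p)] at this
  simp only [Nat.add_sub_cancel] at this
  rw [← this, Y]
  congr 1
  refine Matrix.ext fun i j => ?_
  simp only [Matrix.of_apply]
  split_ifs with hi
  · rw [hi]; congr 1; push_cast; ring
  · rfl

theorem neg_one_pow_mul_self {A : Type*} [CommRing A] (m : ℕ) : (-1 : A) ^ m * (-1) ^ m = 1 := by
  rw [← mul_pow]; simp

/-- The identity $E(-t)H(t)=1$ for the generating functions of the $Y_p$ and $\sigma_p$, obtained by
moving all terms of `Y_succ` to one side. -/
theorem sum_Y_mul_sigmaPoly (k : ℕ) {p : ℕ} (hp : 0 < p) :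
    ∑ i ∈ Finset.range (p + 1), (-1) ^ i * Y k i * sigmaPoly k ((p : ℤ) - i) = 0 := by
  obtain ⟨p, rfl⟩ := Nat.exists_eq_succ_of_ne_zero hp.ne'
  rw [Finset.sum_range_succ, Nat.succ_eq_add_one, Y_succ, ← Finset.sum_range_reflect]
  have : sigmaPoly k (((p + 1 : ℕ) : ℤ) - ((p + 1 : ℕ) : ℤ)) = 1 := by simp [sigmaPoly]
  rw [this, mul_one, Finset.mul_sum, ← Finset.sum_add_distrib]
  refine Finset.sum_eq_zero fun j hj => ?_
  rw [Finset.mem_range] at hj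
  rw [show ((p + 1 : ℕ) : ℤ) - ((p + 1 - 1 - j : ℕ) : ℤ) = (j : ℤ) + 1 by omega,
    show p + 1 - 1 - j = p - j by omega]
  have h2 : (-1 : PolyRing k) ^ (p + 1) = -((-1) ^ (p - j) * (-1) ^ j) := by
    rw [← pow_add, Nat.sub_add_cancel (by omega), pow_succ]; ring
  have h3 : ((-1 : PolyRing k) ^ j) * (-1) ^ j = 1 :=
    neg_one_pow_mul_self j
  rw [h2]
  linear_combination (-(-1) ^ (p - j) * sigmaPoly k (j + 1) * Y k (p - j)) * h3

/-! ### The quasi-periodic sequence and its recurrence. -/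

/-- The class of `Y_p` in `Λ(l,k)`. -/
def elem (l k p : ℕ) : Lam l k := Ideal.Quotient.mk (relIdeal l k) (Y k p)

theorem elem_zero (l k : ℕ) : elem l k 0 = 1 := by simp [elem, Y]

theorem elem_eq_zero {l k p : ℕ} (h1 : l < p) (h2 : p < k + l) : elem l k p = 0 :=
  Ideal.Quotient.eq_zero_iff_mem.2 (Ideal.subset_span (Or.inl ⟨p, h1, h2, rfl⟩))

theorem elem_add (l k : ℕ) : elem l k (k + l) = -((-1) ^ k * q l k) := by
  have : Ideal.Quotient.mk (relIdeal l k) (Y k (k + l) + (-1) ^ k * qPoly k) = 0 :=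
    Ideal.Quotient.eq_zero_iff_mem.2 (Ideal.subset_span (Or.inr rfl))
  rw [map_add, map_mul, map_pow, map_neg, map_one] at this
  exact eq_neg_of_add_eq_zero_left this

/-- The classes of the `σ_p`, `p < k + l`, continued quasi-periodically to all integers so as to
satisfy a linear recurrence of order `l`. -/
def hPer (l k : ℕ) (p : ℤ) : Lam l k :=
  if p < 0 then 0 else ((-1) ^ (l + 1) * q l k) ^ (p / (k + l : ℤ)).toNat *
    Ideal.Quotient.mk (relIdeal l k) (sigmaPoly k (p % (k + l : ℤ)))

theorem hPer_neg {l k : ℕ} {p : ℤ} (hp : p < 0) : hPer l k p = 0 := if_pos hp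

theorem hPer_of_lt {l k : ℕ} {p : ℤ} (hp : p < k + l) :
    hPer l k p = Ideal.Quotient.mk (relIdeal l k) (sigmaPoly k p) := by
  by_cases h : p < 0
  · rw [hPer_neg h, sigmaPoly, dif_neg (by omega), if_neg (by omega), map_zero]
  · rw [hPer, if_neg h, Int.ediv_eq_zero_of_lt (by omega) hp, Int.emod_eq_of_lt (by omega) hp]
    simp

theorem hPer_zero {l k : ℕ} (hk : 0 < k) : hPer l k 0 = 1 := by
  rw [hPer_of_lt (by omega)]
  simp [sigmaPoly]

/-- For $-l<p<0$ both sides vanish, since then $k<p+n<n$. At $p=-l$ the left side would be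
$\sigma_k$, so the bound is sharp in general. -/
theorem hPer_add {l k : ℕ} (hk : 0 < k) {p : ℤ} (hp : -(l : ℤ) < p) :
    hPer l k (p + (k + l)) = ((-1) ^ (l + 1) * q l k) * hPer l k p := by
  by_cases h : p < 0
  · rw [hPer_neg h, mul_zero, hPer_of_lt (by omega), sigmaPoly, dif_neg (by omega),
      if_neg (by omega), map_zero]
  · have hn : (0 : ℤ) < k + l := by omega
    have h1 : (p + (k + l : ℤ)) / (k + l : ℤ) = p / (k + l : ℤ) + 1 :=
      Int.add_ediv_of_dvd_right dvd_rfl |>.trans (by rw [Int.ediv_self hn.ne'])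
    have h2 : 0 ≤ p / (k + l : ℤ) := Int.ediv_nonneg (by omega) hn.le
    rw [hPer, hPer, if_neg h, if_neg (by omega), h1, Int.add_emod_right,
      Int.toNat_add h2 (by norm_num)]
    simp only [Int.toNat_one, pow_succ]
    ring

/-- Below $n$ this is the duality identity, cut off at $l$ because $Y_{l+1},\dots,Y_{n-1}$ vanish.
At $n$ the lost term $(-1)^nY_n=(-1)^{l+1}q$ is replaced by the new value $h_n$. Beyond $n$
quasi-periodicity takes over. -/
theorem sum_elem_mul_hPer {l k : ℕ} (hl : 0 < l) (hk : 0 < k) (p : ℕ) (hp : 0 < p) :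
    ∑ i ∈ Finset.range (l + 1), (-1) ^ i * elem l k i * hPer l k ((p : ℤ) - i) = 0 := by
  induction p using Nat.strong_induction_on with
  | _ p ih =>
  have hY := congrArg (Ideal.Quotient.mk (relIdeal l k)) (sum_Y_mul_sigmaPoly k hp)
  simp only [map_sum, map_mul, map_pow, map_neg, map_one, map_zero] at hY
  have hext : ∀ g : ℕ → Lam l k, ∑ i ∈ Finset.range (l + 1), (-1) ^ i * elem l k i * g i =
      ∑ i ∈ Finset.range (k + l), (-1) ^ i * elem l k i * g i := fun g => by
    refine Finset.sum_subset (by simp; omega) fun i hi hi' => ?_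
    simp only [Finset.mem_range] at hi hi'
    rw [elem_eq_zero (by omega) hi, mul_zero, zero_mul]
  rcases lt_trichotomy p (k + l) with h | h | h
  · rw [hext, ← hY]
    symm
    refine (Finset.sum_subset (by simp; omega) fun i hi hi' => ?_).trans
      (Finset.sum_congr rfl fun i hi => ?_)
    · simp only [Finset.mem_range] at hi hi'
      rw [← hPer_of_lt (by omega), hPer_neg (by omega), mul_zero]
    · rw [← hPer_of_lt (by omega)]; rfl
  · subst h
    rw [Finset.sum_range_succ] at hY
    change (∑ i ∈ Finset.range (k + l), (-1) ^ i * elem l k i * _) +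
      (-1) ^ (k + l) * elem l k (k + l) * _ = 0 at hY
    rw [← hext, elem_add, Finset.sum_range_succ'] at hY
    rw [Finset.sum_range_succ']
    have h0 : hPer l k (((k + l : ℕ) : ℤ) - ((0 : ℕ) : ℤ)) = (-1) ^ (l + 1) * q l k := by
      have := hPer_add (l := l) hk (p := 0) (by omega)
      rw [hPer_zero hk, mul_one] at this
      rw [← this]
      congr 1; push_cast; ring
    have h1 : sigmaPoly k (((k + l : ℕ) : ℤ) - ((k + l : ℕ) : ℤ)) = 1 := by simp [sigmaPoly]
    have h2 : sigmaPoly k (((k + l : ℕ) : ℤ) - ((0 : ℕ) : ℤ)) = 0 := by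
      rw [sigmaPoly, dif_neg (by omega), if_neg (by omega)]
    have h3 : ∀ i ∈ Finset.range l, (-1) ^ (i + 1) * elem l k (i + 1) *
        hPer l k (((k + l : ℕ) : ℤ) - ((i + 1 : ℕ) : ℤ)) = (-1) ^ (i + 1) * elem l k (i + 1) *
        Ideal.Quotient.mk (relIdeal l k) (sigmaPoly k (((k + l : ℕ) : ℤ) - ((i + 1 : ℕ) : ℤ))) :=
      fun i _ => by rw [hPer_of_lt (by push_cast; omega)]
    rw [Finset.sum_congr rfl h3, h0, elem_zero]
    rw [h1, h2, map_one, map_zero] at hY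
    have h4 : ((-1 : Lam l k) ^ k) * (-1) ^ k = 1 :=
      neg_one_pow_mul_self (A := Lam l k) k
    rw [pow_add] at hY
    rw [pow_succ]
    linear_combination hY + (-1) ^ l * q l k * h4
  · obtain ⟨p', rfl⟩ := Nat.exists_eq_add_of_lt h
    have := ih (p' + 1) (by omega) (by omega)
    rw [← mul_zero ((-1) ^ (l + 1) * q l k), ← this, Finset.mul_sum]
    refine Finset.sum_congr rfl fun i hi => ?_
    rw [Finset.mem_range] at hi
    rw [show ((k + l + p' + 1 : ℕ) : ℤ) - i = ((p' + 1 : ℕ) : ℤ) - i + (k + l) by push_cast; ring,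
      hPer_add hk (by push_cast; omega)]
    ring

theorem hPer_rec {l k : ℕ} (hl : 0 < l) (hk : 0 < k) (p : ℤ) (hp : 0 < p) :
    hPer l k p = ∑ i : Fin l, ((-1) ^ (l - i + 1) * elem l k (l - i)) * hPer l k (p - l + i) := by
  lift p to ℕ using hp.le
  have := sum_elem_mul_hPer hl hk p (by omega)
  rw [Finset.sum_range_succ', ← Finset.sum_range_reflect, ← Fin.sum_univ_eq_sum_range
    (fun j => (-1) ^ (l - 1 - j + 1) * elem l k (l - 1 - j + 1) *
      hPer l k ((p : ℤ) - ((l - 1 - j + 1 : ℕ) : ℤ)))] at this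
  simp only [pow_zero, elem_zero, one_mul, Nat.cast_zero, sub_zero] at this
  rw [← sub_eq_zero, ← this, sub_eq_add_neg, add_comm, ← Finset.sum_neg_distrib]
  congr 1
  refine Finset.sum_congr rfl fun i _ => ?_
  have hi := i.2
  rw [show l - 1 - (i : ℕ) + 1 = l - i by omega,
    show (p : ℤ) - ((l - i : ℕ) : ℤ) = p - l + i by omega, pow_succ]
  ring

/-! ### Schur classes as determinants of size $l$, and the Pieri rule before cancellation. -/

theorem mem_column {p i j : ℕ} : (i, j) ∈ column p ↔ i < p ∧ j = 0 := by
  rw [← YoungDiagram.mem_cells]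
  simp only [column, Finset.mem_product, Finset.mem_range]
  omega

theorem rowLen_column (p i : ℕ) : (column p).rowLen i = if i < p then 1 else 0 := by
  refine eq_of_forall_lt_iff fun j => ?_
  rw [← YoungDiagram.mem_iff_lt_rowLen, mem_column]
  split_ifs <;> omega

theorem colLen_zero_column (p : ℕ) : (column p).colLen 0 = p := by
  refine eq_of_forall_lt_iff fun j => ?_
  rw [← YoungDiagram.mem_iff_lt_colLen, mem_column]
  omega

theorem rowLen_eq_zero {lam : YoungDiagram} {i : ℕ} (h : lam.colLen 0 ≤ i) : lam.rowLen i = 0 := by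
  by_contra h0
  have := YoungDiagram.mem_iff_lt_colLen.1
    (YoungDiagram.mem_iff_lt_rowLen.2 (Nat.pos_of_ne_zero h0) : (i, 0) ∈ lam)
  omega

theorem jt_rowLen {l k : ℕ} (hk : 0 < k) {lam : YoungDiagram} (h : InRect l k lam) :
    jt (hPer l k) (fun i : Fin l => (lam.rowLen i : ℤ)) = sigma l k lam := by
  rw [jt, det_eq_det_of_le (hPer_zero hk) (fun p hp => hPer_neg hp) lam.rowLen h.1
    (fun i hi => rowLen_eq_zero hi), sigma]
  refine Eq.trans ?_ (RingHom.map_det (S := Lam l k) (Ideal.Quotient.mk (relIdeal l k)) _).symm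
  congr 1
  refine Matrix.ext fun i j => ?_
  have h1 : lam.rowLen i ≤ lam.rowLen 0 := lam.rowLen_anti 0 i (Nat.zero_le _)
  have := h.2
  have := h.1
  have := j.2
  simp only [Matrix.of_apply, RingHom.mapMatrix_apply, Matrix.map_apply]
  rw [hPer_of_lt (by omega)]

/-- The vertical Pieri rule, with uncancelled terms. -/
theorem sigma_column_mul_jt {l k : ℕ} (hl : 0 < l) (hk : 0 < k) {p : ℕ} (hp : p ≤ l)
    (a : Fin l → ℤ) (ha : ∀ i, 0 ≤ a i) :
    sigma l k (column p) * jt (hPer l k) a = ∑ S ∈ Finset.powersetCard p Finset.univ,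
      jt (hPer l k) fun i => a i + if i ∈ S then 1 else 0 := by
  obtain ⟨N, hN⟩ := exists_companion (fun i => (-1) ^ (l - i + 1) * elem l k (l - i)) (hPer_rec hl hk)
  have key := coeff_det_mul_jt N hN
  rw [← key a ha p]
  congr 1
  -- At `a = 0` the determinant is $1$, so the coefficient of $\det(1+XN)$ can be read off; there
  -- only $S=\{0,\dots,p-1\}$ survives, and it yields $\sigma_{(1^p)}$.
  have h0 : jt (hPer l k) (fun i : Fin l => (0 : ℤ)) = 1 := by
    have := det_eq_det_of_le (h := hPer l k) (hPer_zero hk) (fun p hp => hPer_neg hp) (fun _ => 0)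
      (Nat.zero_le l) (fun _ _ => rfl)
    simpa [jt] using this
  have h1 := key (fun _ => 0) (fun _ => le_rfl) p
  rw [h0, mul_one] at h1
  rw [h1]
  set S₀ : Finset (Fin l) := Finset.univ.filter fun i => (i : ℕ) < p with hS₀
  have hc : S₀.card = p := by rw [hS₀, Fin.card_filter_val_lt, min_eq_right hp]
  rw [Finset.sum_eq_single S₀, ← jt_rowLen hk]
  · congr 1
    funext i
    simp [rowLen_column, hS₀]
  · exact ⟨by rwa [colLen_zero_column], by rw [rowLen_column]; split_ifs <;> omega⟩
  · intro S hS hne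
    have hS := (Finset.mem_powersetCard.1 hS).2
    by_contra hz
    -- If `j + 1` is in `S` and `j` is not, rows `j` and `j + 1` coincide. So a surviving `S` is an
    -- initial segment.
    have hlow : ∀ j : ℕ, ∀ hj : j + 1 < l, (⟨j + 1, hj⟩ : Fin l) ∈ S →
        (⟨j, by omega⟩ : Fin l) ∈ S := by
      intro j hj hjS
      by_contra hjS'
      refine hz (jt_eq_zero_of_row_eq_mul (i := ⟨j + 1, hj⟩) (j := ⟨j, by omega⟩) (by simp) 1 fun x => ?_)
      rw [one_mul, if_pos hjS, if_neg hjS']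
      congr 1; push_cast; ring
    have hlow' : ∀ d j : ℕ, ∀ hj : j + d < l, (⟨j + d, hj⟩ : Fin l) ∈ S →
        (⟨j, by omega⟩ : Fin l) ∈ S := by
      intro d
      induction d with
      | zero => intro j hj h; exact h
      | succ d ih => intro j hj h; exact ih j (by omega) (hlow (j + d) hj h)
    obtain ⟨i, hi, hi'⟩ := Finset.not_subset.1
      (fun hsub => hne (Finset.eq_of_subset_of_card_le hsub (by omega)))
    obtain ⟨j, hj, hj'⟩ := Finset.not_subset.1
      (fun hsub => hne (Finset.eq_of_subset_of_card_le hsub (by omega)).symm)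
    simp only [hS₀, Finset.mem_filter, Finset.mem_univ, true_and] at hi' hj
    refine hj' (hlow' (i - j) j (by omega) ?_)
    convert hi using 1
    exact Fin.ext (by simp; omega)
  · intro h
    exact absurd (Finset.mem_powersetCard.2 ⟨Finset.subset_univ _, hc⟩) h

/-! ### Cylindric diagrams -/

theorem colLen_eq_zero {lam : YoungDiagram} {j : ℕ} (h : lam.rowLen 0 ≤ j) : lam.colLen j = 0 := by
  by_contra h0
  have := YoungDiagram.mem_iff_lt_rowLen.1
    (YoungDiagram.mem_iff_lt_colLen.2 (Nat.pos_of_ne_zero h0) : (0, j) ∈ lam)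
  omega

theorem lt_rowLen_iff_lt_colLen {lam : YoungDiagram} {i j : ℕ} :
    j < lam.rowLen i ↔ i < lam.colLen j := by
  rw [← YoungDiagram.mem_iff_lt_rowLen, YoungDiagram.mem_iff_lt_colLen]

theorem rowLen_zero_le_iff {lam : YoungDiagram} {k : ℕ} :
    lam.rowLen 0 ≤ k ↔ ∀ j, k ≤ j → lam.colLen j = 0 := by
  refine ⟨fun h j hj => colLen_eq_zero (h.trans hj), fun h => ?_⟩
  by_contra h0
  have := lt_rowLen_iff_lt_colLen.1 (not_le.1 h0)
  rw [h k le_rfl] at this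
  omega

theorem le_iff_colLen {rho rho' : YoungDiagram} :
    rho ≤ rho' ↔ ∀ j, rho.colLen j ≤ rho'.colLen j := by
  constructor
  · intro h j
    by_contra h0
    have := h (YoungDiagram.mem_iff_lt_colLen.2 (not_le.1 h0))
    exact absurd (YoungDiagram.mem_iff_lt_colLen.1 this) (lt_irrefl _)
  · rintro h ⟨i, j⟩ hc
    exact YoungDiagram.mem_iff_lt_colLen.2 ((YoungDiagram.mem_iff_lt_colLen.1 hc).trans_le (h j))

theorem le_iff_colLen_of_width {rho rho' : YoungDiagram} {k : ℕ} (h : rho.rowLen 0 ≤ k) :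
    rho ≤ rho' ↔ ∀ j < k, rho.colLen j ≤ rho'.colLen j := by
  rw [le_iff_colLen]
  refine ⟨fun h j _ => h j, fun h' j => ?_⟩
  by_cases hj : j < k
  · exact h' j hj
  · rw [rowLen_zero_le_iff.1 h j (not_lt.1 hj)]
    exact Nat.zero_le _

theorem eq_of_colLen_of_width {rho rho' : YoungDiagram} {k : ℕ} (h : rho.rowLen 0 ≤ k)
    (h' : rho'.rowLen 0 ≤ k) (hc : ∀ j < k, rho.colLen j = rho'.colLen j) : rho = rho' :=
  le_antisymm ((le_iff_colLen_of_width h).2 fun j hj => (hc j hj).le)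
    ((le_iff_colLen_of_width h').2 fun j hj => (hc j hj).ge)

/-- A diagram with at most `k` columns whose first column exceeds its `k`-th column by at most `l`,
i.e. a fundamental domain of a cylindric diagram. -/
def Cyl (l k : ℕ) (rho : YoungDiagram) : Prop :=
  rho.rowLen 0 ≤ k ∧ rho.colLen 0 ≤ rho.colLen (k - 1) + l

theorem InRect.cyl {l k : ℕ} {nu : YoungDiagram} (h : InRect l k nu) : Cyl l k nu :=
  ⟨h.2, h.1.trans (Nat.le_add_left _ _)⟩

theorem InRect.transpose {l k : ℕ} {nu : YoungDiagram} (h : InRect l k nu) :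
    InRect k l nu.transpose := by
  rw [InRect, YoungDiagram.colLen_transpose, YoungDiagram.rowLen_transpose]
  exact ⟨h.2, h.1⟩

theorem card_transpose (nu : YoungDiagram) : nu.transpose.card = nu.card := by
  refine Finset.card_bij (fun c _ => c.swap) ?_ ?_ ?_
  · intro c hc
    rwa [YoungDiagram.mem_cells, YoungDiagram.mem_transpose] at hc
  · intro a _ b _ h
    exact Prod.swap_injective h
  · intro c hc
    refine ⟨c.swap, ?_, Prod.swap_swap c⟩
    rw [YoungDiagram.mem_cells, YoungDiagram.mem_transpose, Prod.swap_swap]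
    exact hc

theorem card_eq_sum_colLen {rho : YoungDiagram} {k : ℕ} (h : rho.rowLen 0 ≤ k) :
    rho.card = ∑ j ∈ Finset.range k, rho.colLen j := by
  rw [YoungDiagram.card, Finset.card_eq_sum_card_fiberwise (f := Prod.snd) (t := Finset.range k)]
  · refine Finset.sum_congr rfl fun j _ => ?_
    rw [YoungDiagram.colLen_eq_card]
    rfl
  · rintro ⟨i, j⟩ hc
    have := YoungDiagram.mem_iff_lt_rowLen.1 (rho.up_left_mem (Nat.zero_le i) le_rfl hc)
    simp only [Finset.coe_range, Set.mem_Iio]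
    omega

/-- The diagram with given column lengths. -/
def ofCols (k : ℕ) (c : ℕ → ℕ) (hc : Antitone c) : YoungDiagram where
  cells := (Finset.range (c 0) ×ˢ Finset.range k).filter fun x => x.1 < c x.2
  isLowerSet := by
    rintro ⟨a, b⟩ ⟨i, j⟩ ⟨h1, h2⟩ h
    simp only [Finset.coe_filter, Finset.mem_product, Finset.mem_range, Set.mem_ofPred_eq] at h ⊢
    simp only at h1 h2
    have := hc h2
    omega

theorem colLen_ofCols {k : ℕ} {c : ℕ → ℕ} {hc : Antitone c} (j : ℕ) :
    (ofCols k c hc).colLen j = if j < k then c j else 0 := by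
  refine eq_of_forall_lt_iff fun i => ?_
  rw [← YoungDiagram.mem_iff_lt_colLen, ← YoungDiagram.mem_cells]
  simp only [ofCols, Finset.mem_filter, Finset.mem_product, Finset.mem_range]
  have := hc (Nat.zero_le j)
  split_ifs <;> omega

theorem rowLen_ofCols_le {k : ℕ} {c : ℕ → ℕ} {hc : Antitone c} : (ofCols k c hc).rowLen 0 ≤ k :=
  rowLen_zero_le_iff.2 fun j hj => by rw [colLen_ofCols, if_neg (not_lt.2 hj)]

theorem rowLen_addRim_le {l k : ℕ} {nu : YoungDiagram} : (addRim l k nu).rowLen 0 ≤ k := by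
  by_contra h
  have := mem_addRim.1 (YoungDiagram.mem_iff_lt_rowLen.2 (not_le.1 h))
  omega

theorem Cyl.colLen_addRim_succ {l k : ℕ} {rho : YoungDiagram} (h : Cyl l k rho) {j : ℕ}
    (hj : j + 1 < k) : (addRim l k rho).colLen (j + 1) = rho.colLen j + 1 :=
  QSchur.colLen_addRim_succ h.2 hj

theorem Cyl.addRim {l k : ℕ} (hk : 0 < k) {rho : YoungDiagram} (h : Cyl l k rho) :
    Cyl l k (addRim l k rho) := by
  refine ⟨rowLen_addRim_le, ?_⟩
  rw [colLen_addRim_zero hk]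
  obtain rfl | ⟨k, rfl⟩ : k = 1 ∨ ∃ k', k = k' + 2 := by
    rcases k with _ | _ | k <;> simp_all
  · rw [colLen_addRim_zero hk]; omega
  · have e : k + 2 - 1 = k + 1 := rfl
    rw [e, h.colLen_addRim_succ (by omega)]
    have := rho.colLen_anti k (k + 1) (by omega)
    omega

theorem Cyl.addRims {l k : ℕ} (hk : 0 < k) {rho : YoungDiagram} (h : Cyl l k rho) (m : ℕ) :
    Cyl l k (addRims l k rho m) := by
  induction m with
  | zero => exact h
  | succ m ih =>
    rw [QSchur.addRims, Function.iterate_succ_apply']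
    exact ih.addRim hk

theorem addRims_zero (l k : ℕ) (nu : YoungDiagram) : addRims l k nu 0 = nu := rfl

theorem addRims_succ (l k : ℕ) (nu : YoungDiagram) (m : ℕ) :
    addRims l k nu (m + 1) = addRim l k (addRims l k nu m) :=
  Function.iterate_succ_apply' _ _ _

theorem Cyl.card_addRim {l k : ℕ} (hk : 0 < k) {rho : YoungDiagram} (h : Cyl l k rho) :
    (QSchur.addRim l k rho).card = rho.card + (k + l) := by
  obtain ⟨k, rfl⟩ := Nat.exists_eq_succ_of_ne_zero hk.ne'
  rw [card_eq_sum_colLen rowLen_addRim_le, card_eq_sum_colLen h.1, Nat.succ_eq_add_one,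
    Finset.sum_range_succ', Finset.sum_range_succ, colLen_addRim_zero hk,
    Finset.sum_congr rfl fun j hj => h.colLen_addRim_succ (by simpa using hj),
    Finset.sum_add_distrib]
  simp
  ring

theorem Cyl.card_addRims {l k : ℕ} (hk : 0 < k) {rho : YoungDiagram} (h : Cyl l k rho) (m : ℕ) :
    (QSchur.addRims l k rho m).card = rho.card + m * (k + l) := by
  induction m with
  | zero => simp [addRims_zero]
  | succ m ih => rw [addRims_succ, (h.addRims hk m).card_addRim hk, ih]; ring

theorem Cyl.addRim_injective {l k : ℕ} (hk : 0 < k) {rho rho' : YoungDiagram} (h : Cyl l k rho)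
    (h' : Cyl l k rho') (e : QSchur.addRim l k rho = QSchur.addRim l k rho') : rho = rho' := by
  refine eq_of_colLen_of_width h.1 h'.1 fun j hj => ?_
  have e' := fun j => congrArg (fun r => YoungDiagram.colLen r j) e
  by_cases hj' : j + 1 < k
  · have := e' (j + 1)
    simp only [h.colLen_addRim_succ hj', h'.colLen_addRim_succ hj'] at this
    omega
  · have := e' 0
    simp only [colLen_addRim_zero hk] at this
    rw [show j = k - 1 by omega]
    omega

theorem lt_colLen_addRims {l k : ℕ} (hk : 0 < k) {nu : YoungDiagram} {m : ℕ} (hm : 0 < m) :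
    l < (addRims l k nu m).colLen 0 := by
  obtain ⟨m, rfl⟩ := Nat.exists_eq_succ_of_ne_zero hm.ne'
  rw [Nat.succ_eq_add_one, addRims_succ, colLen_addRim_zero hk]
  omega

/-- A first column of length at most $l$ separates $m=0$ from $m>0$; otherwise one hook is stripped
from each side. Together with `Cyl.exists_addRims`, cylindric diagrams correspond to pairs
$(\nu,m)$. -/
theorem addRims_injective {l k : ℕ} (hk : 0 < k) {nu nu' : YoungDiagram} {m m' : ℕ}
    (h : InRect l k nu) (h' : InRect l k nu') (e : addRims l k nu m = addRims l k nu' m') :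
    nu = nu' ∧ m = m' := by
  induction m generalizing m' with
  | zero =>
    rcases Nat.eq_zero_or_pos m' with rfl | hm
    · exact ⟨e, rfl⟩
    · have := lt_colLen_addRims (l := l) (nu := nu') hk hm
      rw [← e, addRims_zero] at this
      exact absurd h.1 (not_le.2 this)
  | succ m ih =>
    rcases m' with _ | m'
    · have := lt_colLen_addRims (l := l) (nu := nu) hk (Nat.succ_pos m)
      rw [e, addRims_zero] at this
      exact absurd h'.1 (not_le.2 this)
    · rw [addRims_succ, addRims_succ] at e
      obtain ⟨h1, h2⟩ := ih ((h.cyl.addRims hk m).addRim_injective hk (h'.cyl.addRims hk m') e)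
      exact ⟨h1, by rw [h2]⟩

/-- Adding a hook rotates the column lengths, with offset $l+1$ at the wrap-around and $1$
elsewhere; here the rotation is undone. -/
theorem Cyl.exists_addRim {l k : ℕ} (hk : 0 < k) {rho : YoungDiagram} (h : Cyl l k rho)
    (h0 : l < rho.colLen 0) : ∃ rho', Cyl l k rho' ∧ QSchur.addRim l k rho' = rho := by
  have hc : Antitone fun j => if j + 1 < k then rho.colLen (j + 1) - 1 else rho.colLen 0 - l - 1 := by
    refine antitone_nat_of_succ_le fun j => ?_
    have h1 := rho.colLen_anti (j + 1) (j + 1 + 1) (by omega)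
    have h2 := h.2
    split_ifs with h3 h4
    · omega
    · omega
    · have h4 := rho.colLen_anti (j + 1) (k - 1) (by omega)
      omega
    · rfl
  -- All $k$ columns are therefore nonempty, so the truncated subtraction of $1$ loses nothing.
  have hk1 : 0 < rho.colLen (k - 1) := by have := h.2; omega
  have hcyl : Cyl l k (ofCols k _ hc) := by
    refine ⟨rowLen_ofCols_le, ?_⟩
    rw [colLen_ofCols, colLen_ofCols, if_pos hk, if_pos (show k - 1 < k by omega),
      if_neg (show ¬ k - 1 + 1 < k by omega)]
    have := rho.colLen_anti 0 (0 + 1) (by omega)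
    split_ifs <;> omega
  refine ⟨_, hcyl, eq_of_colLen_of_width rowLen_addRim_le h.1 fun j hj => ?_⟩
  rcases j with _ | j
  · rw [colLen_addRim_zero hk, colLen_ofCols, if_pos (by omega), if_neg (by omega)]
    omega
  · rw [hcyl.colLen_addRim_succ hj, colLen_ofCols, if_pos (by omega), if_pos hj]
    have := rho.colLen_anti (j + 1) (k - 1) (by omega)
    omega

theorem Cyl.exists_addRims {l k : ℕ} (hk : 0 < k) {rho : YoungDiagram} (h : Cyl l k rho) :
    ∃ nu m, InRect l k nu ∧ QSchur.addRims l k nu m = rho := by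
  induction hn : rho.card using Nat.strong_induction_on generalizing rho with
  | _ n ih =>
  by_cases h0 : l < rho.colLen 0
  · obtain ⟨rho', h', rfl⟩ := h.exists_addRim hk h0
    rw [h'.card_addRim hk] at hn
    obtain ⟨nu, m, h1, rfl⟩ := ih rho'.card (by omega) h' rfl
    exact ⟨nu, m + 1, h1, addRims_succ _ _ _ _⟩
  · exact ⟨rho, 0, ⟨not_lt.1 h0, h.1⟩, rfl⟩

/-! ### Strips in cylindric diagrams -/

/-- `rho'` is obtained from `rho` by adding a cylindric strip, which has at most one box in each row
if `b` is true, and at most one box in each column if `b` is false. -/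
def Step (b : Bool) (l k : ℕ) (rho rho' : YoungDiagram) : Prop :=
  rho ≤ rho' ∧ if b then (∀ j, j + 1 < k → rho'.colLen (j + 1) ≤ rho.colLen j) ∧
      rho'.colLen 0 ≤ rho.colLen (k - 1) + l
    else ∀ j < k, rho'.colLen j ≤ rho.colLen j + 1

theorem addRim_le_addRim_iff {l k : ℕ} (hk : 0 < k) {rho rho' : YoungDiagram} (h : Cyl l k rho)
    (h' : Cyl l k rho') : addRim l k rho ≤ addRim l k rho' ↔ rho ≤ rho' := by
  rw [le_iff_colLen_of_width rowLen_addRim_le, le_iff_colLen_of_width h.1]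
  constructor
  · intro H j hj
    by_cases hj' : j + 1 < k
    · have := H (j + 1) hj'
      rw [h.colLen_addRim_succ hj', h'.colLen_addRim_succ hj'] at this
      omega
    · have := H 0 hk
      rw [colLen_addRim_zero hk, colLen_addRim_zero hk] at this
      rw [show j = k - 1 by omega]
      omega
  · intro H j hj
    rcases j with _ | j
    · rw [colLen_addRim_zero hk, colLen_addRim_zero hk]
      have := H (k - 1) (by omega)
      omega
    · rw [h.colLen_addRim_succ hj, h'.colLen_addRim_succ hj]
      have := H j (by omega)
      omega

/-- The strip conditions are invariant under rotation of the cylinder: the hook only permutes the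
inequalities cyclically. -/
theorem step_addRim_iff {b : Bool} {l k : ℕ} (hk : 0 < k) {rho rho' : YoungDiagram}
    (h : Cyl l k rho) (h' : Cyl l k rho') :
    Step b l k (addRim l k rho) (addRim l k rho') ↔ Step b l k rho rho' := by
  rw [Step, Step, addRim_le_addRim_iff hk h h']
  refine and_congr_right fun hle => ?_
  cases b
  · simp only [Bool.false_eq_true, if_false]
    constructor
    · intro H j hj
      by_cases hj' : j + 1 < k
      · have := H (j + 1) hj'
        rw [h.colLen_addRim_succ hj', h'.colLen_addRim_succ hj'] at this
        omega
      · have := H 0 hk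
        rw [colLen_addRim_zero hk, colLen_addRim_zero hk] at this
        rw [show j = k - 1 by omega]
        omega
    · intro H j hj
      rcases j with _ | j
      · rw [colLen_addRim_zero hk, colLen_addRim_zero hk]
        have := H (k - 1) (by omega)
        omega
      · rw [h.colLen_addRim_succ hj, h'.colLen_addRim_succ hj]
        have := H j (by omega)
        omega
  · simp only [if_true]
    obtain rfl | ⟨k, rfl⟩ : k = 1 ∨ ∃ k', k = k' + 2 := by
      rcases k with _ | _ | k <;> simp_all
    · simp only [colLen_addRim_zero hk]
      constructor
      · rintro ⟨_, H⟩
        exact ⟨fun j hj => by omega, by simp at *; omega⟩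
      · rintro ⟨_, H⟩
        exact ⟨fun j hj => by omega, by simp at *; omega⟩
    · have e : k + 2 - 1 = k + 1 := rfl
      rw [e, colLen_addRim_zero hk, h.colLen_addRim_succ (j := k) (by omega), e]
      constructor
      · rintro ⟨H1, H2⟩
        constructor
        · intro j hj
          by_cases hj' : j + 2 < k + 2
          · have := H1 (j + 1) hj'
            rw [h.colLen_addRim_succ (by omega), h'.colLen_addRim_succ (by omega)] at this
            omega
          · obtain rfl : j = k := by omega
            omega
        · have := H1 0 (by omega)
          rw [h'.colLen_addRim_succ (by omega), colLen_addRim_zero hk, e] at this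
          omega
      · rintro ⟨H1, H2⟩
        constructor
        · intro j hj
          rw [h'.colLen_addRim_succ (by omega)]
          rcases j with _ | j
          · rw [colLen_addRim_zero hk, e]
            omega
          · rw [h.colLen_addRim_succ (by omega)]
            have := H1 j (by omega)
            omega
        · have := H1 k (by omega)
          omega

theorem step_addRims_add_iff {b : Bool} {l k : ℕ} (hk : 0 < k) {nu nu' : YoungDiagram}
    (h : Cyl l k nu) (h' : Cyl l k nu') (m d : ℕ) :
    Step b l k (addRims l k nu m) (addRims l k nu' (m + d)) ↔
      Step b l k nu (addRims l k nu' d) := by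
  induction m with
  | zero => rw [Nat.zero_add, addRims_zero]
  | succ m ih =>
    rw [show m + 1 + d = (m + d) + 1 by ring, addRims_succ, addRims_succ,
      step_addRim_iff hk (h.addRims hk _) (h'.addRims hk _), ih]

theorem addRims_add_le_iff {l k : ℕ} (hk : 0 < k) {nu nu' : YoungDiagram}
    (h : Cyl l k nu) (h' : Cyl l k nu') (m d : ℕ) :
    addRims l k nu (m + d) ≤ addRims l k nu' m ↔ addRims l k nu d ≤ nu' := by
  induction m with
  | zero => rw [Nat.zero_add, addRims_zero]
  | succ m ih =>
    rw [show m + 1 + d = (m + d) + 1 by ring, addRims_succ, addRims_succ,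
      addRim_le_addRim_iff hk (h.addRims hk _) (h'.addRims hk _), ih]

/-- Common hooks can be stripped. If `m > m'`, containment would put a diagram with first column
longer than $l$ inside $\nu'\subset l\times k$. -/
theorem step_addRims_iff {b : Bool} {l k : ℕ} (hk : 0 < k) {nu nu' : YoungDiagram}
    (h : InRect l k nu) (h' : InRect l k nu') (m m' : ℕ) :
    Step b l k (addRims l k nu m) (addRims l k nu' m') ↔
      m ≤ m' ∧ Step b l k nu (addRims l k nu' (m' - m)) := by
  by_cases hm : m ≤ m'
  · obtain ⟨d, rfl⟩ := Nat.exists_eq_add_of_le hm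
    rw [step_addRims_add_iff hk h.cyl h'.cyl, Nat.add_sub_cancel_left]
    simp
  · refine ⟨fun H => ?_, fun H => absurd H.1 hm⟩
    obtain ⟨d, rfl⟩ := Nat.exists_eq_add_of_le (not_le.1 hm).le
    have h1 := (addRims_add_le_iff hk h.cyl h'.cyl m' d).1 H.1
    have h2 := lt_colLen_addRims (l := l) (nu := nu) hk (m := d) (by omega)
    have h3 := le_iff_colLen.1 h1 0
    have := h'.1
    omega

/-- Transposition exchanges the two kinds of cylindric strips. -/
theorem step_false_iff_step_true {l k : ℕ} (hl : 0 < l) (hk : 0 < k) {lam nu : YoungDiagram}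
    (h : InRect l k lam) (h' : InRect l k nu) (m : ℕ) :
    Step false l k lam (addRims l k nu m) ↔
      Step true k l lam.transpose (addRims k l nu.transpose m) := by
  have hr : ∀ i j, j < lam.rowLen i ↔ i < lam.colLen j := fun _ _ => lt_rowLen_iff_lt_colLen
  have hw : ∀ i j, j < nu.rowLen i ↔ i < nu.colLen j := fun _ _ => lt_rowLen_iff_lt_colLen
  have hrk : ∀ i, lam.rowLen i ≤ k := fun i => (lam.rowLen_anti 0 i (Nat.zero_le _)).trans h.2
  have hwk : ∀ i, nu.rowLen i ≤ k := fun i => (nu.rowLen_anti 0 i (Nat.zero_le _)).trans h'.2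
  have hcl : ∀ j, lam.colLen j ≤ l := fun j => (lam.colLen_anti 0 j (Nat.zero_le _)).trans h.1
  have hvl : ∀ j, nu.colLen j ≤ l := fun j => (nu.colLen_anti 0 j (Nat.zero_le _)).trans h'.1
  simp only [Step, Bool.false_eq_true, if_false, if_true]
  rcases m with _ | _ | m
  · rw [addRims_zero, addRims_zero, YoungDiagram.transpose_le_iff]
    refine and_congr_right fun _ => ?_
    simp only [YoungDiagram.colLen_transpose]
    constructor
    · intro H
      refine ⟨fun i hi => ?_, (hwk 0).trans (Nat.le_add_left _ _)⟩
      refine le_of_forall_lt fun j hj => ?_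
      have h1 := (hw _ _).1 hj
      have h2 := H j (hj.trans_le (hwk _))
      rw [hr]
      omega
    · rintro ⟨H, -⟩ j hj
      refine le_of_forall_lt fun i hi => ?_
      rcases i with _ | i
      · omega
      · have h1 := (hw _ _).2 hi
        have h2 := H i (hi.trans_le (hvl _))
        have := (hr i j).1 (by omega)
        omega
  · rw [addRims_succ, addRims_zero, addRims_succ, addRims_zero,
      le_iff_colLen_of_width h.2, le_iff_colLen_of_width h.transpose.2]
    have hc1 := h'.cyl
    have hc2 := h'.transpose.cyl
    -- With one hook, `a1` translates the upper bounds on the strip between rows and columns,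
    -- including the wrap-around, and `a2` translates the containment.
    have a1 : (∀ i < l, nu.rowLen i < lam.rowLen i) ↔
        lam.colLen 0 = l ∧ nu.colLen (k - 1) = 0 ∧
          ∀ j, j + 1 < k → nu.colLen j ≤ lam.colLen (j + 1) := by
      constructor
      · intro H
        refine ⟨le_antisymm (hcl 0) ?_, ?_, fun j hj => le_of_forall_lt fun i hi => ?_⟩
        · have := H (l - 1) (by omega)
          have := (hr (l - 1) 0).1 (by omega)
          omega
        · by_contra h0
          have h1 := (hw 0 (k - 1)).2 (by omega)
          have := H 0 hl
          have := hrk 0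
          omega
        · have h1 := (hw _ _).2 hi
          have h2 := H i (hi.trans_le (hvl _))
          rw [← hr]
          omega
      · rintro ⟨H1, H2, H3⟩ i hi
        rw [hr]
        rcases hj : nu.rowLen i with _ | j
        · omega
        · have h1 := (hw i j).1 (by omega)
          have h2 := hwk i
          by_cases hjk : j + 1 < k
          · exact h1.trans_le (H3 j hjk)
          · rw [show j = k - 1 by omega] at h1
            omega
    have a2 : (∀ i, i + 1 < l → lam.rowLen (i + 1) ≤ nu.rowLen i + 1) ↔
        ∀ j, j + 1 < k → lam.colLen (j + 1) ≤ nu.colLen j + 1 := by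
      constructor
      · intro H j hj
        refine le_of_forall_lt fun i hi => ?_
        rcases i with _ | i
        · omega
        · have h1 := (hr _ _).2 hi
          have h2 := H i (hi.trans_le (hcl _))
          have := (hw i j).1 (by omega)
          omega
      · intro H i hi
        refine le_of_forall_lt fun j hj => ?_
        rcases j with _ | j
        · omega
        · have h1 := (hr _ _).1 hj
          have h2 := H j (hj.trans_le (hrk _))
          have := (hw i j).2 (by omega)
          omega
    constructor
    · rintro ⟨H1, H2⟩
      have h1 := H1 0 hk
      have h2 := H2 0 hk
      rw [colLen_addRim_zero hk] at h1 h2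
      have h3 := hcl 0
      have b1 := a1.2 ⟨by omega, by omega, fun j hj => by
        have := H2 (j + 1) hj
        rw [hc1.colLen_addRim_succ hj] at this
        omega⟩
      have b2 := a2.2 fun j hj => by
        have := H1 (j + 1) hj
        rwa [hc1.colLen_addRim_succ hj] at this
      refine ⟨fun i hi => ?_, fun i hi => ?_, ?_⟩
      · rcases i with _ | i
        · rw [colLen_addRim_zero hl, YoungDiagram.colLen_transpose]
          have := hrk 0
          omega
        · rw [hc2.colLen_addRim_succ hi, YoungDiagram.colLen_transpose,
            YoungDiagram.colLen_transpose]
          exact b2 i hi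
      · rw [hc2.colLen_addRim_succ hi, YoungDiagram.colLen_transpose,
            YoungDiagram.colLen_transpose]
        exact b1 i (by omega)
      · rw [colLen_addRim_zero hl, YoungDiagram.colLen_transpose, YoungDiagram.colLen_transpose]
        have := b1 (l - 1) (by omega)
        omega
    · rintro ⟨H1, H2, H3⟩
      rw [colLen_addRim_zero hl, YoungDiagram.colLen_transpose,
        YoungDiagram.colLen_transpose] at H3
      obtain ⟨b1, b2, b3⟩ := a1.1 fun i hi => by
        by_cases hi' : i + 1 < l
        · have := H2 i hi'
          rwa [hc2.colLen_addRim_succ hi', YoungDiagram.colLen_transpose,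
            YoungDiagram.colLen_transpose] at this
        · rw [show i = l - 1 by omega]
          omega
      have b4 := a2.1 fun i hi => by
        have := H1 (i + 1) hi
        rwa [hc2.colLen_addRim_succ hi, YoungDiagram.colLen_transpose,
            YoungDiagram.colLen_transpose] at this
      refine ⟨fun j hj => ?_, fun j hj => ?_⟩
      · rcases j with _ | j
        · rw [colLen_addRim_zero hk]; omega
        · rw [hc1.colLen_addRim_succ hj]
          exact b4 j hj
      · rcases j with _ | j
        · rw [colLen_addRim_zero hk]; omega
        · rw [hc1.colLen_addRim_succ hj]
          have := b3 j hj
          omega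
  -- Two or more hooks never fit into a single strip starting from a partition in the rectangle, so
  -- both sides are false.
  · rw [addRims_succ l, addRims_succ k]
    constructor
    · rintro ⟨_, H⟩
      exfalso
      have h1 := H 0 hk
      rw [colLen_addRim_zero hk] at h1
      have h2 := hcl 0
      have h3 := lt_colLen_addRims (l := l) (nu := nu) hk (Nat.succ_pos m)
      have h4 := (h'.cyl.addRims hk (m + 1)).2
      simp only [Nat.succ_eq_add_one] at h3
      omega
    · rintro ⟨_, H1, H2⟩
      exfalso
      have h3 := lt_colLen_addRims (l := k) (nu := nu.transpose) hl (Nat.succ_pos m)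
      have hc := h'.transpose.cyl.addRims hl (m + 1)
      simp only [Nat.succ_eq_add_one] at h3
      rw [colLen_addRim_zero hl] at H2
      simp only [YoungDiagram.colLen_transpose] at H1 H2
      by_cases h2 : 1 < l
      · have h4 := H1 0 h2
        rw [hc.colLen_addRim_succ h2] at h4
        have := hrk 0
        omega
      · obtain rfl : l = 1 := by omega
        have := hrk (1 - 1)
        simp only [Nat.sub_self] at H2 this
        omega

variable {rho lam : YoungDiagram} {r : ℕ}

/-! ### Counting proper tableaux -/

/-- The strict order if `b` is true, the weak one otherwise. -/
def rel (b : Bool) (x y : Fin r) : Prop := if b then x < y else x ≤ y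

theorem rel.le {b : Bool} {x y : Fin r} (h : rel b x y) : x ≤ y := by
  cases b
  · exact h
  · exact le_of_lt h

theorem rel_castSucc {b : Bool} {x y : Fin r} : rel b x.castSucc y.castSucc ↔ rel b x y := by
  cases b <;> simp [rel]

theorem rel_castSucc_last {b : Bool} {x : Fin r} : rel b x.castSucc (Fin.last r) := by
  cases b <;> simp [rel, Fin.castSucc_lt_last, Fin.le_last]

theorem not_rel_last_castSucc {b : Bool} {x : Fin r} : ¬ rel b (Fin.last r) x.castSucc :=
  fun h => absurd h.le (not_le.2 (Fin.castSucc_lt_last x))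

theorem rel_last_last {b : Bool} : rel b (Fin.last r) (Fin.last r) ↔ b = false := by
  cases b <;> simp [rel]

/-- Proper conjugate tableaux (if `b` is true) and proper tableaux (if `b` is false). -/
def IsProperTableau (b : Bool) (l k : ℕ) (T : Filling rho lam r) : Prop :=
  (∀ c d, c.1.1 = d.1.1 → c.1.2 < d.1.2 → rel b (T c) (T d)) ∧
  (∀ c d, c.1.2 = d.1.2 → c.1.1 < d.1.1 → rel (!b) (T c) (T d)) ∧
  ∀ c, c.1.2 = 0 → ∀ p, c.1.1 = l + p →
    (p, k - 1) ∈ lam ∨ ∃ d, d.1 = (p, k - 1) ∧ rel b (T d) (T c)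

/-- The number of proper (conjugate) tableaux of content `mu` on `rho/lam`. -/
def count (b : Bool) (l k : ℕ) (lam : YoungDiagram) {r : ℕ} (mu : Fin r → ℕ)
    (rho : YoungDiagram) : ℕ :=
  Nat.card {T : Filling rho lam r // lam ≤ rho ∧ HasContent T mu ∧ IsProperTableau b l k T}

theorem quantumKostka_eq_count (l k : ℕ) (lam : YoungDiagram) (mu : Fin r → ℕ) (nu : YoungDiagram)
    (m : ℕ) : quantumKostka l k lam mu nu m = count false l k lam mu (addRims l k nu m) := by
  simp [quantumKostka, count, IsTableau, IsProper, IsProperTableau, rel, and_assoc]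

theorem conjQuantumKostka_eq_count (l k : ℕ) (lam : YoungDiagram) (mu : Fin r → ℕ)
    (nu : YoungDiagram) (m : ℕ) :
    conjQuantumKostka l k lam mu nu m = count true l k lam mu (addRims l k nu m) := by
  simp [conjQuantumKostka, count, IsConjTableau, IsConjProper, IsProperTableau, rel, and_assoc]

open Classical in
theorem count_zero (b : Bool) (l k : ℕ) (lam : YoungDiagram) (mu : Fin 0 → ℕ) (rho : YoungDiagram) :
    count b l k lam mu rho = if rho = lam then 1 else 0 := by
  split_ifs with h
  · subst h
    have : IsEmpty {c : ℕ × ℕ // c ∈ rho.cells \ rho.cells} := ⟨fun c => by simpa using c.2⟩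
    rw [count, Nat.card_eq_one_iff_unique]
    refine ⟨⟨fun T T' => Subtype.ext (funext fun c => isEmptyElim c)⟩,
      ⟨⟨fun c => isEmptyElim c, le_rfl, fun i => i.elim0, fun c => isEmptyElim c,
        fun c => isEmptyElim c, fun c => isEmptyElim c⟩⟩⟩
  · rw [count, Nat.card_eq_zero]
    refine Or.inl ⟨fun T => h (le_antisymm (fun c hc => ?_) T.2.1)⟩
    by_contra hc'
    exact (T.1 ⟨c, Finset.mem_sdiff.2 ⟨hc, hc'⟩⟩).elim0

/-- The comparison goes through the corner box in the row of `d` and the column of `c`, which lies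
in the skew shape. Consequently the boxes without the largest number, together with `lam`, form a
diagram. -/
theorem IsProperTableau.mono {b : Bool} {l k : ℕ} {T : Filling rho lam r}
    (hT : IsProperTableau b l k T) {c d : {c : ℕ × ℕ // c ∈ rho.cells \ lam.cells}}
    (h : c.1 ≤ d.1) : T c ≤ T d := by
  obtain ⟨⟨i, j⟩, hc⟩ := c
  obtain ⟨⟨i', j'⟩, hd⟩ := d
  obtain ⟨h1, h2⟩ : i ≤ i' ∧ j ≤ j' := h
  simp only [Finset.mem_sdiff, YoungDiagram.mem_cells] at hc hd
  have he : (i', j) ∈ rho.cells \ lam.cells := by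
    simp only [Finset.mem_sdiff, YoungDiagram.mem_cells]
    exact ⟨rho.up_left_mem le_rfl h2 hd.1, fun h => hc.2 (lam.up_left_mem h1 le_rfl h)⟩
  calc T ⟨(i, j), _⟩ ≤ T ⟨(i', j), he⟩ := by
        rcases h1.eq_or_lt with rfl | h1
        · exact le_rfl
        · exact (hT.2.1 ⟨(i, j), _⟩ ⟨(i', j), he⟩ rfl h1).le
    _ ≤ T ⟨(i', j'), _⟩ := by
        rcases h2.eq_or_lt with rfl | h2
        · exact le_rfl
        · exact (hT.1 ⟨(i', j), he⟩ ⟨(i', j'), _⟩ rfl h2).le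

/-- Were the first column too long, its box $l$ rows below the first free box of the $k$-th column
would lie outside `lam` and have no partner as required by properness. -/
theorem IsProperTableau.cyl {b : Bool} {l k : ℕ} {T : Filling rho lam r}
    (hT : IsProperTableau b l k T) (hle : lam ≤ rho) (hlam : InRect l k lam)
    (hrho : rho.rowLen 0 ≤ k) : Cyl l k rho := by
  refine ⟨hrho, ?_⟩
  by_contra h
  rw [not_le] at h
  have hmem : (l + rho.colLen (k - 1), 0) ∈ rho.cells \ lam.cells := by
    rw [Finset.mem_sdiff, YoungDiagram.mem_cells, YoungDiagram.mem_cells,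
      YoungDiagram.mem_iff_lt_colLen, YoungDiagram.mem_iff_lt_colLen]
    have := hlam.1
    omega
  have hnot : (rho.colLen (k - 1), k - 1) ∉ rho := by
    rw [YoungDiagram.mem_iff_lt_colLen]; omega
  rcases hT.2.2 ⟨_, hmem⟩ rfl _ rfl with h1 | ⟨d, hd, -⟩
  · exact hnot (hle h1)
  · have := (Finset.mem_sdiff.1 d.2).1
    rw [hd] at this
    exact hnot this

variable {rho' : YoungDiagram}

open Classical in
/-- Extend a filling of `rho'/lam` to `rho/lam` by a new largest number. -/
def extend (rho : YoungDiagram) (T : Filling rho' lam r) : Filling rho lam (r + 1) := fun c =>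
  if h : c.1 ∈ rho' then
    (T ⟨c.1, Finset.mem_sdiff.2 ⟨h, (Finset.mem_sdiff.1 c.2).2⟩⟩).castSucc
  else Fin.last r

theorem extend_of_mem {T : Filling rho' lam r} (c : {c : ℕ × ℕ // c ∈ rho.cells \ lam.cells})
    (h : c.1 ∈ rho') : extend rho T c =
      (T ⟨c.1, Finset.mem_sdiff.2 ⟨h, (Finset.mem_sdiff.1 c.2).2⟩⟩).castSucc := dif_pos h

theorem extend_of_notMem {T : Filling rho' lam r} (c : {c : ℕ × ℕ // c ∈ rho.cells \ lam.cells})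
    (h : c.1 ∉ rho') : extend rho T c = Fin.last r := dif_neg h

theorem extend_mk_of_mem {T : Filling rho' lam r} {c : ℕ × ℕ} (hc : c ∈ rho.cells \ lam.cells)
    (h : c ∈ rho') : extend rho T ⟨c, hc⟩ =
      (T ⟨c, Finset.mem_sdiff.2 ⟨h, (Finset.mem_sdiff.1 hc).2⟩⟩).castSucc := dif_pos h

theorem extend_mk_of_notMem {T : Filling rho' lam r} {c : ℕ × ℕ}
    (hc : c ∈ rho.cells \ lam.cells) (h : c ∉ rho') : extend rho T ⟨c, hc⟩ = Fin.last r := dif_neg h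

theorem extend_eq_last_iff {T : Filling rho' lam r}
    (c : {c : ℕ × ℕ // c ∈ rho.cells \ lam.cells}) :
    extend rho T c = Fin.last r ↔ c.1 ∉ rho' := by
  refine ⟨fun h h' => ?_, extend_of_notMem c⟩
  rw [extend_of_mem c h'] at h
  exact absurd h (Fin.castSucc_lt_last _).ne

theorem hasContent_extend_iff {T : Filling rho' lam r} {mu : Fin (r + 1) → ℕ} (h1 : lam ≤ rho')
    (h2 : rho' ≤ rho) : HasContent (extend rho T) mu ↔
      HasContent T (fun i => mu i.castSucc) ∧ rho'.card + mu (Fin.last r) = rho.card := by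
  have e1 : ∀ i : Fin r, Nat.card {c // extend rho T c = i.castSucc} = Nat.card {c // T c = i} := by
    intro i
    symm
    refine Nat.card_congr (Equiv.ofBijective (fun c => ⟨⟨c.1.1, Finset.mem_sdiff.2
      ⟨h2 (Finset.mem_sdiff.1 c.1.2).1, (Finset.mem_sdiff.1 c.1.2).2⟩⟩, ?_⟩) ⟨?_, ?_⟩)
    · rw [extend_mk_of_mem _ (Finset.mem_sdiff.1 c.1.2).1]
      exact congrArg Fin.castSucc c.2
    · intro c d h
      simp only [Subtype.mk.injEq] at h
      exact Subtype.ext (Subtype.ext h)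
    · rintro ⟨c, hc⟩
      have hm : c.1 ∈ rho' := by
        by_contra hm
        rw [extend_of_notMem c hm] at hc
        exact absurd hc.symm (Fin.castSucc_lt_last i).ne
      rw [extend_of_mem c hm] at hc
      exact ⟨⟨_, Fin.castSucc_injective _ hc⟩, rfl⟩
  have e2 : rho'.card + Nat.card {c // extend rho T c = Fin.last r} = rho.card := by
    have : Nat.card {c // extend rho T c = Fin.last r} = (rho.cells \ rho'.cells).card := by
      rw [← Fintype.card_coe, ← Nat.card_eq_fintype_card]
      refine Nat.card_congr (Equiv.ofBijective (fun c => ⟨c.1.1, Finset.mem_sdiff.2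
        ⟨(Finset.mem_sdiff.1 c.1.2).1, (extend_eq_last_iff _).1 c.2⟩⟩) ⟨?_, ?_⟩)
      · intro c d h
        simp only [Subtype.mk.injEq] at h
        exact Subtype.ext (Subtype.ext h)
      · rintro ⟨c, hc⟩
        have hc := Finset.mem_sdiff.1 hc
        exact ⟨⟨⟨c, Finset.mem_sdiff.2 ⟨hc.1, fun h => hc.2 (h1 h)⟩⟩,
          (extend_eq_last_iff _).2 hc.2⟩, rfl⟩
    rw [this, Finset.card_sdiff_of_subset (YoungDiagram.cells_subset_iff.2 h2)]
    exact Nat.add_sub_cancel' (Finset.card_le_card (YoungDiagram.cells_subset_iff.2 h2))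
  rw [HasContent, Fin.forall_fin_succ']
  refine and_congr (forall_congr' fun i => by rw [e1]) ?_
  omega

/-- The condition for the boxes of `rho/rho'` to carry equal largest entries in a proper
(conjugate) tableau. -/
def IsStrip (b : Bool) (l k : ℕ) (rho' rho : YoungDiagram) : Prop :=
  (∀ i j j', j < j' → (i, j) ∉ rho' → (i, j') ∈ rho → b = false) ∧
  (∀ i i' j, i < i' → (i, j) ∉ rho' → (i', j) ∈ rho → b = true) ∧
  ∀ p, (l + p, 0) ∈ rho → (l + p, 0) ∉ rho' → (p, k - 1) ∈ if b then rho' else rho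

/-- For `b = false` properness is automatic from `Cyl l k rho`; for `b = true` it is the inequality
between the new first column and the old last column. -/
theorem isStrip_iff_step {b : Bool} {l k : ℕ} (hle : rho' ≤ rho) (h' : Cyl l k rho')
    (h : Cyl l k rho) : IsStrip b l k rho' rho ↔ Step b l k rho' rho := by
  simp only [IsStrip, Step, hle, true_and, YoungDiagram.mem_iff_lt_colLen]
  have h1 := h.2
  have h2 := h'.2
  cases b
  · simp only [Bool.false_eq_true, if_false]
    constructor
    · rintro ⟨-, H, -⟩ j _
      by_contra hj
      exact H (rho'.colLen j) (rho'.colLen j + 1) j (by omega) (by omega) (by omega)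
    · intro H
      refine ⟨fun _ _ _ _ _ _ => trivial, fun i i' j hi h3 h4 => ?_, fun p h3 h4 => by omega⟩
      have hj : j < k := by
        by_contra hj
        rw [colLen_eq_zero (h.1.trans (not_lt.1 hj))] at h4
        omega
      have := H j hj
      omega
  · simp only [if_true]
    constructor
    · rintro ⟨H1, -, H3⟩
      refine ⟨fun j _ => ?_, ?_⟩
      · by_contra hj
        exact absurd (H1 (rho'.colLen j) j (j + 1) (by omega) (by omega) (by omega)) (by simp)
      · by_contra hj
        have := H3 (rho'.colLen (k - 1)) (by omega) (by omega)
        omega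
    · rintro ⟨H1, H2⟩
      refine ⟨fun i j j' hj h3 h4 => ?_, fun _ _ _ _ _ _ => trivial, fun p h3 h4 => by omega⟩
      exfalso
      have h5 := rho.colLen_anti (j + 1) j' (by omega)
      by_cases hj' : j + 1 < k
      · have := H1 j hj'
        omega
      · rw [colLen_eq_zero (h.1.trans (not_lt.1 hj'))] at h5
        omega

/-- The new number exceeds all old ones and an old box never lies weakly to the lower right of a new
one, so row and column conditions on new boxes concern only pairs of them; the rest is properness of
new boxes in the first column. -/
theorem isProperTableau_extend_iff {b : Bool} {l k : ℕ} {T : Filling rho' lam r} (h1 : lam ≤ rho')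
    (h2 : rho' ≤ rho) : IsProperTableau b l k (extend rho T) ↔
      IsProperTableau b l k T ∧ IsStrip b l k rho' rho := by
  have hup : ∀ c : {c : ℕ × ℕ // c ∈ rho'.cells \ lam.cells}, c.1 ∈ rho.cells \ lam.cells :=
    fun c => Finset.mem_sdiff.2 ⟨h2 (Finset.mem_sdiff.1 c.2).1, (Finset.mem_sdiff.1 c.2).2⟩
  have hval : ∀ c : {c : ℕ × ℕ // c ∈ rho'.cells \ lam.cells},
      extend rho T ⟨c.1, hup c⟩ = (T c).castSucc :=
    fun c => extend_of_mem _ (Finset.mem_sdiff.1 c.2).1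
  have hnew : ∀ c : ℕ × ℕ, c ∈ rho → c ∉ rho' → c ∈ rho.cells \ lam.cells :=
    fun c hc hc' => Finset.mem_sdiff.2 ⟨hc, fun h => hc' (h1 h)⟩
  have hpair : ∀ (b' : Bool) (c d : {c : ℕ × ℕ // c ∈ rho.cells \ lam.cells}), c.1 ≤ d.1 →
      (∀ c' d' : {c : ℕ × ℕ // c ∈ rho'.cells \ lam.cells}, c'.1 = c.1 → d'.1 = d.1 →
        rel b' (T c') (T d')) →
      (c.1 ∉ rho' → d.1 ∉ rho' → b' = false) → rel b' (extend rho T c) (extend rho T d) := by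
    intro b' c d hcd H1 H2
    by_cases hd : d.1 ∈ rho'
    · have hc : c.1 ∈ rho' := rho'.isLowerSet hcd hd
      rw [extend_of_mem c hc, extend_of_mem d hd, rel_castSucc]
      exact H1 _ _ rfl rfl
    · by_cases hc : c.1 ∈ rho'
      · rw [extend_of_mem c hc, extend_of_notMem d hd]
        exact rel_castSucc_last
      · rw [extend_of_notMem c hc, extend_of_notMem d hd, rel_last_last]
        exact H2 hc hd
  constructor
  · rintro ⟨H1, H2, H3⟩
    refine ⟨⟨fun c d hc hd => ?_, fun c d hc hd => ?_, fun c hc p hp => ?_⟩, ?_, ?_, ?_⟩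
    · have := H1 ⟨c.1, hup c⟩ ⟨d.1, hup d⟩ hc hd
      rwa [hval, hval, rel_castSucc] at this
    · have := H2 ⟨c.1, hup c⟩ ⟨d.1, hup d⟩ hc hd
      rwa [hval, hval, rel_castSucc] at this
    · refine (H3 ⟨c.1, hup c⟩ hc p hp).imp_right ?_
      rintro ⟨d, hd, hr⟩
      rw [hval] at hr
      by_cases hm : d.1 ∈ rho'
      · rw [extend_of_mem d hm, rel_castSucc] at hr
        exact ⟨_, hd, hr⟩
      · rw [extend_of_notMem d hm] at hr
        exact absurd hr not_rel_last_castSucc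
    · intro i j j' hj hm hm'
      have hn' : (i, j') ∉ rho' := fun h => hm (rho'.up_left_mem le_rfl hj.le h)
      have := H1 ⟨(i, j), hnew _ (rho.up_left_mem le_rfl hj.le hm') hm⟩
        ⟨(i, j'), hnew _ hm' hn'⟩ rfl hj
      rwa [extend_of_notMem _ hm, extend_of_notMem _ hn', rel_last_last] at this
    · intro i i' j hi hm hm'
      have hn' : (i', j) ∉ rho' := fun h => hm (rho'.up_left_mem hi.le le_rfl h)
      have := H2 ⟨(i, j), hnew _ (rho.up_left_mem hi.le le_rfl hm') hm⟩
        ⟨(i', j), hnew _ hm' hn'⟩ rfl hi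
      rw [extend_of_notMem _ hm, extend_of_notMem _ hn', rel_last_last] at this
      simpa using this
    · intro p hm hm'
      rcases H3 ⟨_, hnew _ hm hm'⟩ rfl p rfl with h | ⟨d, hd, hr⟩
      · split_ifs
        · exact h1 h
        · exact h2 (h1 h)
      · rw [extend_mk_of_notMem _ hm'] at hr
        rw [← hd]
        split_ifs with hb
        · by_contra hdm
          rw [extend_of_notMem d hdm, rel_last_last, hb] at hr
          exact absurd hr (by simp)
        · exact (Finset.mem_sdiff.1 d.2).1
  · rintro ⟨⟨H1, H2, H3⟩, S1, S2, S3⟩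
    refine ⟨fun c d hc hd => ?_, fun c d hc hd => ?_, fun c hc p hp => ?_⟩
    · refine hpair _ _ _ ⟨hc.le, hd.le⟩ (fun c' d' e e' => ?_) (fun hm hm' => ?_)
      · exact H1 c' d' (by rw [e, e', hc]) (by rwa [e, e'])
      · refine S1 c.1.1 c.1.2 d.1.2 hd hm ?_
        rw [hc]
        exact (Finset.mem_sdiff.1 d.2).1
    · refine hpair _ _ _ ⟨hd.le, hc.le⟩ (fun c' d' e e' => ?_) (fun hm hm' => ?_)
      · exact H2 c' d' (by rw [e, e', hc]) (by rwa [e, e'])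
      · rw [S2 c.1.1 d.1.1 c.1.2 hd hm (by rw [hc]; exact (Finset.mem_sdiff.1 d.2).1)]
        rfl
    · by_cases hm : c.1 ∈ rho'
      · rw [extend_of_mem c hm]
        refine (H3 ⟨c.1, Finset.mem_sdiff.2 ⟨hm, (Finset.mem_sdiff.1 c.2).2⟩⟩ hc p hp).imp_right ?_
        rintro ⟨d, hd, hr⟩
        exact ⟨⟨d.1, hup d⟩, hd, by rw [hval, rel_castSucc]; exact hr⟩
      · rw [extend_of_notMem c hm]
        have hce : c.1 = (l + p, 0) := Prod.ext hp hc
        have := S3 p (by rw [← hce]; exact (Finset.mem_sdiff.1 c.2).1) (by rwa [← hce])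
        by_cases hl : (p, k - 1) ∈ lam
        · exact Or.inl hl
        · right
          cases b
          · simp only [Bool.false_eq_true, if_false] at this
            exact ⟨⟨_, Finset.mem_sdiff.2 ⟨this, hl⟩⟩, rfl, Fin.le_last _⟩
          · simp only [if_true] at this
            refine ⟨⟨_, Finset.mem_sdiff.2 ⟨h2 this, hl⟩⟩, rfl, ?_⟩
            rw [extend_of_mem _ this]
            exact rel_castSucc_last

/-- The diagram of the boxes which do not carry the largest number. -/
theorem exists_extend {b : Bool} {l k : ℕ} {T : Filling rho lam (r + 1)}
    (hT : IsProperTableau b l k T) (hle : lam ≤ rho) :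
    ∃ (rho' : YoungDiagram) (T' : Filling rho' lam r), lam ≤ rho' ∧ rho' ≤ rho ∧
      extend rho T' = T := by
  classical
  let rho' : YoungDiagram :=
    { cells := rho.cells.filter fun c => ∀ h : c ∈ rho.cells \ lam.cells, T ⟨c, h⟩ ≠ Fin.last r
      isLowerSet := by
        intro c d hdc hc
        simp only [Finset.coe_filter, Set.mem_ofPred_eq] at hc ⊢
        refine ⟨rho.isLowerSet hdc hc.1, fun h hlast => ?_⟩
        have hc' : c ∈ rho.cells \ lam.cells :=
          Finset.mem_sdiff.2 ⟨hc.1, fun h' => (Finset.mem_sdiff.1 h).2 (lam.isLowerSet hdc h')⟩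
        have := hT.mono (c := ⟨d, h⟩) (d := ⟨c, hc'⟩) hdc
        rw [hlast] at this
        exact hc.2 hc' (Fin.last_le_iff.1 this) }
  have hmem : ∀ c, c ∈ rho' ↔ c ∈ rho ∧
      ∀ h : c ∈ rho.cells \ lam.cells, T ⟨c, h⟩ ≠ Fin.last r := fun c => Finset.mem_filter
  have hup : ∀ c, c ∈ rho'.cells \ lam.cells → c ∈ rho.cells \ lam.cells := fun c hc =>
    Finset.mem_sdiff.2 ⟨((hmem c).1 (Finset.mem_sdiff.1 hc).1).1, (Finset.mem_sdiff.1 hc).2⟩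
  refine ⟨rho', fun c => (T ⟨c.1, hup c.1 c.2⟩).castPred
    (((hmem c.1).1 (Finset.mem_sdiff.1 c.2).1).2 _), ?_, ?_, ?_⟩
  · exact fun c hc => (hmem c).2 ⟨hle hc, fun h => absurd hc (Finset.mem_sdiff.1 h).2⟩
  · exact fun c hc => ((hmem c).1 hc).1
  · funext c
    by_cases h : c.1 ∈ rho'
    · rw [extend_of_mem c h]
      simp
    · rw [extend_of_notMem c h]
      by_contra hne
      exact h ((hmem _).2 ⟨(Finset.mem_sdiff.1 c.2).1, fun _ h' => hne h'.symm⟩)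

open Classical in
/-- Remove the largest number from a proper (conjugate) tableau. -/
theorem count_succ {b : Bool} {l k : ℕ} (hk : 0 < k) (hlam : InRect l k lam)
    (mu : Fin (r + 1) → ℕ) (hrho : Cyl l k rho)
    (hcard : lam.card + ∑ i, mu i = rho.card) :
    count b l k lam mu rho =
      ∑ x ∈ termIndex l k (lam.card + ∑ i : Fin r, mu i.castSucc),
        if Step b l k (addRims l k x.1 x.2) rho then
          count b l k lam (fun i : Fin r => mu i.castSucc) (addRims l k x.1 x.2) else 0 := by
  set N := lam.card + ∑ i : Fin r, mu i.castSucc with hN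
  have hcard' : N + mu (Fin.last r) = rho.card := by
    rw [← hcard, Fin.sum_univ_castSucc, hN, add_assoc]
  have hidx : ∀ x ∈ termIndex l k N, InRect l k x.1 ∧ (addRims l k x.1 x.2).card = N := by
    intro x hx
    simp only [termIndex, rectPartitions, Finset.mem_filter, Finset.mem_product,
      Set.Finite.mem_toFinset, Set.mem_ofPred_eq] at hx
    exact ⟨hx.1.1, by rw [hx.1.1.cyl.card_addRims hk]; exact hx.2⟩
  rw [← Finset.sum_filter, ← Finset.sum_coe_sort]
  simp only [count]
  rw [← Nat.card_sigma]
  symm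
  have hdat : ∀ x : {x // x ∈ (termIndex l k N).filter fun x =>
      Step b l k (addRims l k x.1 x.2) rho},
      InRect l k x.1.1 ∧ (addRims l k x.1.1 x.1.2).card = N ∧
        Step b l k (addRims l k x.1.1 x.1.2) rho := fun x => by
    have := Finset.mem_filter.1 x.2
    exact ⟨(hidx _ this.1).1, (hidx _ this.1).2, this.2⟩
  refine Nat.card_congr (Equiv.ofBijective (fun y => ⟨extend rho y.2.1, ?_, ?_, ?_⟩) ⟨?_, ?_⟩)
  · exact y.2.2.1.trans (hdat y.1).2.2.1
  · exact (hasContent_extend_iff y.2.2.1 (hdat y.1).2.2.1).2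
      ⟨y.2.2.2.1, by rw [(hdat y.1).2.1, hcard']⟩
  · exact (isProperTableau_extend_iff y.2.2.1 (hdat y.1).2.2.1).2 ⟨y.2.2.2.2,
      (isStrip_iff_step (hdat y.1).2.2.1 ((hdat y.1).1.cyl.addRims hk _) hrho).2 (hdat y.1).2.2⟩
  -- The smaller shape is recovered from the extension as the complement of the boxes with the
  -- largest number, and the shape determines $(\nu,m)$.
  · rintro ⟨x, T, hT⟩ ⟨x', T', hT'⟩ h
    have hTT : extend rho T = extend rho T' := congrArg Subtype.val h
    have hsub : ∀ (σ σ' : YoungDiagram) (U : Filling σ lam r) (U' : Filling σ' lam r),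
        lam ≤ σ' → σ ≤ rho → extend rho U = extend rho U' → σ ≤ σ' := by
      intro σ σ' U U' h1 h2 he c hc
      by_contra hc'
      have hm : c ∈ rho.cells \ lam.cells := Finset.mem_sdiff.2 ⟨h2 hc, fun h => hc' (h1 h)⟩
      have := (extend_eq_last_iff (T := U') ⟨c, hm⟩).2 hc'
      rw [← he, extend_eq_last_iff] at this
      exact this hc
    have hrr : addRims l k x.1.1 x.1.2 = addRims l k x'.1.1 x'.1.2 :=
      le_antisymm (hsub _ _ T T' hT'.1 (hdat x).2.2.1 hTT)
        (hsub _ _ T' T hT.1 (hdat x').2.2.1 hTT.symm)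
    obtain ⟨e1, e2⟩ := addRims_injective hk (hdat x).1 (hdat x').1 hrr
    obtain rfl : x = x' := Subtype.ext (Prod.ext e1 e2)
    obtain rfl : T = T' := by
      funext c
      have hm := Finset.mem_sdiff.1 c.2
      have := congrFun hTT ⟨c.1, Finset.mem_sdiff.2 ⟨(hdat x).2.2.1 hm.1, hm.2⟩⟩
      rw [extend_mk_of_mem _ hm.1, extend_mk_of_mem _ hm.1] at this
      exact Fin.castSucc_injective _ this
    rfl
  · rintro ⟨T, hle, hc, hT⟩
    obtain ⟨rho', T', h1, h2, rfl⟩ := exists_extend hT hle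
    obtain ⟨hT1, hS⟩ := (isProperTableau_extend_iff h1 h2).1 hT
    obtain ⟨hc1, hc2⟩ := (hasContent_extend_iff h1 h2).1 hc
    -- Properness of the truncated tableau makes its shape cylindric, hence of the form $\nu[m]$.
    have hcyl : Cyl l k rho' := hT1.cyl h1 hlam
      (rowLen_zero_le_iff.2 fun j hj => Nat.le_zero.1
        ((le_iff_colLen.1 h2 j).trans (colLen_eq_zero (hrho.1.trans hj)).le))
    obtain ⟨nu, m, hnu, rfl⟩ := hcyl.exists_addRims hk
    have hx : (nu, m) ∈ termIndex l k N := by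
      have h3 := hnu.cyl.card_addRims hk m
      simp only [termIndex, rectPartitions, Finset.mem_filter, Finset.mem_product,
        Set.Finite.mem_toFinset, Set.mem_ofPred_eq, Finset.mem_range]
      have : m ≤ m * (k + l) := Nat.le_mul_of_pos_right m (by omega)
      exact ⟨⟨hnu, by omega⟩, by omega⟩
    exact ⟨⟨⟨(nu, m), Finset.mem_filter.2 ⟨hx, (isStrip_iff_step h2 hcyl hrho).1 hS⟩⟩,
      ⟨T', h1, hc1, hT1⟩⟩, rfl⟩

theorem mem_termIndex {l k N : ℕ} (hk : 0 < k) {x : YoungDiagram × ℕ} :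
    x ∈ termIndex l k N ↔ InRect l k x.1 ∧ x.1.card + x.2 * (k + l) = N := by
  simp only [termIndex, rectPartitions, Finset.mem_filter, Finset.mem_product,
    Set.Finite.mem_toFinset, Set.mem_ofPred_eq, Finset.mem_range]
  have : x.2 ≤ x.2 * (k + l) := Nat.le_mul_of_pos_right _ (by omega)
  refine ⟨fun h => ⟨h.1.1, h.2⟩, fun h => ⟨⟨h.1, by omega⟩, h.2⟩⟩

theorem addRims_eq_iff {l k : ℕ} (hk : 0 < k) {lam nu : YoungDiagram} (h : InRect l k lam)
    (h' : InRect l k nu) {m : ℕ} : addRims l k nu m = lam ↔ nu = lam ∧ m = 0 :=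
  ⟨fun e => addRims_injective (m' := 0) hk h' h e, by rintro ⟨rfl, rfl⟩; rfl⟩

/-- Both sides satisfy `count_succ`. Transposing the intermediate $\nu$ and keeping $m$ matches the
summands, once common hooks are stripped from each step. -/
theorem count_transpose {l k : ℕ} (hl : 0 < l) (hk : 0 < k) {r : ℕ} (mu : Fin r → ℕ)
    {lam nu : YoungDiagram} {m : ℕ} (h : InRect l k lam) (h' : InRect l k nu)
    (hcard : lam.card + ∑ i, mu i = nu.card + m * (k + l)) :
    count false l k lam mu (addRims l k nu m) =
      count true k l lam.transpose mu (addRims k l nu.transpose m) := by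
  classical
  induction r generalizing nu m with
  | zero =>
    rw [count_zero, count_zero]
    refine if_congr ?_ rfl rfl
    rw [addRims_eq_iff hk h h', addRims_eq_iff hl h.transpose h'.transpose,
      YoungDiagram.transpose_eq_iff]
  | succ r ih =>
    rw [count_succ hk h mu (h'.cyl.addRims hk m) (by rw [hcard, h'.cyl.card_addRims hk]),
      count_succ hl h.transpose mu (h'.transpose.cyl.addRims hl m)
        (by rw [card_transpose, hcard, h'.transpose.cyl.card_addRims hl, card_transpose,
          add_comm l k])]
    refine Finset.sum_bij' (fun x _ => (x.1.transpose, x.2)) (fun x _ => (x.1.transpose, x.2))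
      (fun x hx => ?_) (fun x hx => ?_) (fun x _ => by simp) (fun x _ => by simp) (fun x hx => ?_)
    · rw [mem_termIndex hk] at hx
      rw [mem_termIndex hl, card_transpose, card_transpose, add_comm l k]
      exact ⟨hx.1.transpose, hx.2⟩
    · rw [mem_termIndex hl, card_transpose, add_comm l k] at hx
      rw [mem_termIndex hk, card_transpose]
      exact ⟨hx.1.transpose, hx.2⟩
    · rw [mem_termIndex hk] at hx
      refine if_congr ?_ (ih _ hx.1 hx.2.symm) rfl
      rw [step_addRims_iff hk hx.1 h', step_addRims_iff hl hx.1.transpose h'.transpose,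
        step_false_iff_step_true hl hk hx.1 h']

/-! ### The quantum Pieri rule -/

/-- The hook rotates the $l$ rows. The sign $(-1)^{l-1}$ of the rotation cancels the sign in the
period factor $(-1)^{l+1}q$. -/
theorem jt_colLen_addRim {l k : ℕ} (hl : 0 < l) (hk : 0 < k) {rho : YoungDiagram}
    (h : Cyl k l rho) :
    jt (hPer l k) (fun i : Fin l => ((addRim k l rho).colLen i : ℤ)) =
      q l k * jt (hPer l k) (fun i : Fin l => (rho.colLen i : ℤ)) := by
  obtain ⟨m, rfl⟩ : ∃ m, l = m + 1 := ⟨l - 1, by omega⟩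
  rw [jt_cycle (m := m) (c := (-1) ^ (m + 1 + 1) * q (m + 1) k) (n := k + (m + 1 : ℕ))
    (fun p hp => hPer_add hk (by push_cast; exact hp)) (fun i => (rho.colLen i : ℤ))]
  · have := neg_one_pow_mul_self (A := Lam (m + 1) k) m
    rw [pow_succ, pow_succ]
    linear_combination q (m + 1) k * jt (hPer (m + 1) k)
      (fun i : Fin (m + 1) => (rho.colLen i : ℤ)) * this
  · intro i
    exact Int.natCast_nonneg _
  · simp only [Fin.val_zero, Fin.val_last]
    rw [colLen_addRim_zero hl, Nat.add_sub_cancel]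
    push_cast
    ring
  · intro i
    simp only [Fin.val_succ, Fin.val_castSucc]
    rw [h.colLen_addRim_succ (by omega)]
    push_cast
    rfl

theorem jt_colLen_addRims {l k : ℕ} (hl : 0 < l) (hk : 0 < k) {rho : YoungDiagram}
    (h : Cyl k l rho) (m : ℕ) :
    jt (hPer l k) (fun i : Fin l => ((addRims k l rho m).colLen i : ℤ)) =
      q l k ^ m * jt (hPer l k) (fun i : Fin l => (rho.colLen i : ℤ)) := by
  induction m with
  | zero => rw [addRims_zero, pow_zero, one_mul]
  | succ m ih => rw [addRims_succ, jt_colLen_addRim hl hk (h.addRims hl m), ih, pow_succ]; ring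

/-- Adding boxes in a set `S` of columns gives a cylindric diagram, or a vanishing determinant. -/
theorem exists_cyl_of_jt_ne_zero {l k : ℕ} (hl : 0 < l) (hk : 0 < k) {lam : YoungDiagram}
    (h : Cyl k l lam) (S : Finset (Fin l))
    (hS : jt (hPer l k) (fun i : Fin l => (lam.colLen i : ℤ) + if i ∈ S then 1 else 0) ≠ 0) :
    ∃ rho, Cyl k l rho ∧ ∀ i : Fin l, rho.colLen i = lam.colLen i + if i ∈ S then 1 else 0 := by
  classical
  set c : ℕ → ℕ := fun j => lam.colLen j + if j ∈ S.map Fin.valEmbedding then 1 else 0 with hc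
  have hcS : ∀ i : Fin l, c i = lam.colLen i + if i ∈ S then 1 else 0 := fun i => by
    simp only [hc, Finset.mem_map, Fin.valEmbedding_apply, Fin.val_inj, exists_eq_right]
  have hge : ∀ j, l ≤ j → c j = 0 := fun j hj => by
    simp only [hc]
    rw [colLen_eq_zero (h.1.trans hj), if_neg]
    simp only [Finset.mem_map, Fin.valEmbedding_apply, not_exists, not_and]
    intro x _ hx
    omega
  have hanti : Antitone c := by
    refine antitone_nat_of_succ_le fun j => ?_
    by_cases hj : j + 1 < l
    · by_contra hlt
      have e0 := hcS ⟨j, by omega⟩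
      have e1 := hcS ⟨j + 1, hj⟩
      have e2 := lam.colLen_anti j (j + 1) (by omega)
      simp only at e0 e1
      have m0 : (⟨j, by omega⟩ : Fin l) ∉ S := fun hm => by
        rw [if_pos hm] at e0
        split_ifs at e1 <;> omega
      have m1 : (⟨j + 1, hj⟩ : Fin l) ∈ S := by
        by_contra hm
        rw [if_neg hm] at e1
        rw [if_neg m0] at e0
        omega
      rw [if_pos m1] at e1
      rw [if_neg m0] at e0
      -- Monotonicity can fail only where two equal columns meet and just the right one grows; the
      -- two rows are then equal.
      refine hS (jt_eq_zero_of_row_eq_mul (i := ⟨j + 1, hj⟩) (j := ⟨j, by omega⟩) (by simp) 1 fun x => ?_)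
      rw [one_mul, if_pos m1, if_neg m0]
      congr 1
      simp only
      push_cast
      omega
    · rw [hge _ (not_lt.1 hj)]
      exact Nat.zero_le _
  have hcyl : c 0 ≤ c (l - 1) + k := by
    by_contra hlt
    have e0 := hcS ⟨0, hl⟩
    have e1 := hcS ⟨l - 1, by omega⟩
    have e2 := h.2
    simp only at e0 e1
    have m1 : (⟨l - 1, by omega⟩ : Fin l) ∉ S := fun hm => by
      rw [if_pos hm] at e1
      split_ifs at e0 <;> omega
    have m0 : (⟨0, hl⟩ : Fin l) ∈ S := by
      by_contra hm
      rw [if_neg hm] at e0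
      rw [if_neg m1] at e1
      omega
    rw [if_neg m1] at e1
    rw [if_pos m0] at e0
    -- Here the first length was exactly $k$ more than the last and only the first grew, so the
    -- entries of row $0$ have index $k+1+(l-1)=n$ larger than those of row $l-1$.
    refine hS (jt_eq_zero_of_row_eq_mul (i := ⟨0, hl⟩) (j := ⟨l - 1, by omega⟩) (fun hh => ?_)
      ((-1) ^ (l + 1) * q l k) fun x => ?_)
    · exact m1 (hh ▸ m0)
    · rw [if_pos m0, if_neg m1, ← hPer_add hk (by simp only; omega)]
      congr 1
      simp only
      omega
  have hcol : ∀ j, j < l → (ofCols l c hanti).colLen j = c j := fun j hj => by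
    rw [colLen_ofCols, if_pos hj]
  refine ⟨ofCols l c hanti, ⟨rowLen_ofCols_le, ?_⟩, fun i => ?_⟩
  · rw [hcol 0 hl, hcol _ (by omega)]
    exact hcyl
  · rw [hcol _ i.2, hcS]

-- The nonvanishing sets `S` inject into the cylindric diagrams reached by a strip with at most one
-- box per column, so each term is a single $q^m$ times a determinant. The index vector is carried
-- by column lengths, i.e. by the transposed diagram.
open Classical in
theorem sigma_column_mul_jt_colLen {l k : ℕ} (hl : 0 < l) (hk : 0 < k) {p : ℕ} (hp : p ≤ l)
    {lam : YoungDiagram} (h : InRect k l lam) :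
    sigma l k (column p) * jt (hPer l k) (fun i : Fin l => (lam.colLen i : ℤ)) =
      ∑ x ∈ termIndex k l (lam.card + p), if Step false k l lam (addRims k l x.1 x.2) then
        q l k ^ x.2 * jt (hPer l k) (fun i : Fin l => (x.1.colLen i : ℤ)) else 0 := by
  rw [sigma_column_mul_jt hl hk hp _ fun i => Int.natCast_nonneg _, ← Finset.sum_filter]
  symm
  set S : YoungDiagram × ℕ → Finset (Fin l) := fun x =>
    Finset.univ.filter fun i => (addRims k l x.1 x.2).colLen i = lam.colLen i + 1 with hS
  have hmem : ∀ x i, i ∈ S x ↔ (addRims k l x.1 x.2).colLen i = lam.colLen i + 1 := by simp [hS]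
  have hcol : ∀ x : YoungDiagram × ℕ, Step false k l lam (addRims k l x.1 x.2) → ∀ i : Fin l,
      (addRims k l x.1 x.2).colLen i = lam.colLen i + if i ∈ S x then 1 else 0 := by
    intro x hx i
    have h1 := le_iff_colLen.1 hx.1 i
    have h2 := hx.2 i i.2
    split_ifs with hi <;> rw [hmem] at hi <;> omega
  have hcard : ∀ rho : YoungDiagram, Cyl k l rho → ∀ U : Finset (Fin l),
      (∀ i : Fin l, rho.colLen i = lam.colLen i + if i ∈ U then 1 else 0) →
      rho.card = lam.card + U.card := by
    intro rho hrho U hU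
    rw [card_eq_sum_colLen hrho.1, card_eq_sum_colLen h.2, ← Fin.sum_univ_eq_sum_range,
      ← Fin.sum_univ_eq_sum_range, Finset.sum_congr rfl fun i _ => hU i, Finset.sum_add_distrib]
    simp
  refine Finset.sum_of_injOn S ?_ ?_ ?_ ?_
  · intro x hx y hy hxy
    simp only [Finset.coe_filter, Set.mem_ofPred_eq, mem_termIndex hl] at hx hy
    obtain ⟨h1, h2⟩ := addRims_injective hl hx.1.1 hy.1.1 (eq_of_colLen_of_width
      (hx.1.1.cyl.addRims hl _).1 (hy.1.1.cyl.addRims hl _).1 fun j hj => by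
        rw [hcol x hx.2 ⟨j, hj⟩, hcol y hy.2 ⟨j, hj⟩, hxy])
    exact Prod.ext h1 h2
  · intro x hx
    simp only [Finset.coe_filter, Set.mem_ofPred_eq, mem_termIndex hl] at hx
    have h1 := hcard _ (hx.1.1.cyl.addRims hl _) _ (hcol x hx.2)
    rw [hx.1.1.cyl.card_addRims hl] at h1
    simp only [Finset.mem_coe, Finset.mem_powersetCard_univ]
    omega
  · intro U hU hU'
    by_contra hne
    obtain ⟨rho, hrho, hc⟩ := exists_cyl_of_jt_ne_zero hl hk h.cyl U hne
    obtain ⟨nu, m, hnu, rfl⟩ := hrho.exists_addRims hl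
    refine hU' ⟨(nu, m), ?_, ?_⟩
    · simp only [Finset.coe_filter, Set.mem_ofPred_eq, mem_termIndex hl]
      have h1 := hcard _ hrho U hc
      rw [hnu.cyl.card_addRims hl, Finset.mem_powersetCard_univ.1 hU] at h1
      refine ⟨⟨hnu, h1⟩, (le_iff_colLen_of_width h.2).2 fun j hj => ?_, fun j hj => ?_⟩
      · rw [hc ⟨j, hj⟩]
        exact Nat.le_add_right _ _
      · rw [hc ⟨j, hj⟩]
        split_ifs <;> simp
    · ext i
      rw [hmem, hc]
      split_ifs with hi <;> simp [hi]
  · intro x hx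
    rw [Finset.mem_filter, mem_termIndex hl] at hx
    rw [← jt_colLen_addRims hl hk hx.1.1.cyl]
    congr 1
    funext i
    rw [hcol x hx.2 i]
    push_cast
    rfl

-- The rows of $\lambda$ are the columns of its transpose; transposing back turns one box per column
-- into one box per row.
open Classical in
theorem sigma_column_mul_sigma {l k : ℕ} (hl : 0 < l) (hk : 0 < k) {p : ℕ} (hp : p ≤ l)
    {lam : YoungDiagram} (h : InRect l k lam) :
    sigma l k (column p) * sigma l k lam =
      ∑ x ∈ termIndex l k (lam.card + p), if Step true l k lam (addRims l k x.1 x.2) then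
        q l k ^ x.2 * sigma l k x.1 else 0 := by
  have := sigma_column_mul_jt_colLen hl hk hp h.transpose
  simp only [YoungDiagram.colLen_transpose] at this
  rw [jt_rowLen hk h] at this
  rw [this]
  refine Finset.sum_bij' (fun x _ => (x.1.transpose, x.2)) (fun x _ => (x.1.transpose, x.2))
      (fun x hx => ?_) (fun x hx => ?_) (fun x _ => by simp) (fun x _ => by simp) (fun x hx => ?_)
  · rw [mem_termIndex hl, card_transpose, add_comm l k] at hx
    rw [mem_termIndex hk, card_transpose]
    exact ⟨hx.1.transpose, hx.2⟩
  · rw [mem_termIndex hk] at hx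
    rw [mem_termIndex hl, card_transpose, card_transpose, add_comm l k]
    exact ⟨hx.1.transpose, hx.2⟩
  · rw [mem_termIndex hl] at hx
    rw [step_false_iff_step_true hk hl h.transpose hx.1, YoungDiagram.transpose_transpose,
      ← jt_rowLen hk hx.1.transpose]
    simp only [YoungDiagram.rowLen_transpose]

theorem prod_sigma_column_mul_sigma {l k : ℕ} (hl : 0 < l) (hk : 0 < k) {r : ℕ} (mu : Fin r → ℕ)
    {lam : YoungDiagram} (h : InRect l k lam) (hmu : ∀ i, mu i ≤ l) :
    (∏ i, sigma l k (column (mu i))) * sigma l k lam =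
      ∑ x ∈ termIndex l k (lam.card + ∑ i, mu i),
        (count true l k lam mu (addRims l k x.1 x.2) : Lam l k) * q l k ^ x.2 * sigma l k x.1 := by
  classical
  induction r with
  | zero =>
    rw [Finset.sum_eq_single (lam, 0)]
    · simp [count_zero, addRims_zero]
    · intro x hx hne
      rw [mem_termIndex hk] at hx
      rw [count_zero, if_neg, Nat.cast_zero, zero_mul, zero_mul]
      rw [addRims_eq_iff hk h hx.1]
      exact fun e => hne (Prod.ext e.1 e.2)
    · intro hn
      exact absurd ((mem_termIndex hk).2 ⟨h, by simp⟩) hn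
  | succ r ih =>
    set N := lam.card + ∑ i : Fin r, mu i.castSucc with hN
    set p := mu (Fin.last r) with hp
    have hNp : lam.card + ∑ i, mu i = N + p := by rw [Fin.sum_univ_castSucc, hN, add_assoc]
    have hshift : ∀ y ∈ termIndex l k N,
        q l k ^ y.2 * (sigma l k (column p) * sigma l k y.1) =
          ∑ x ∈ termIndex l k (N + p), if Step true l k (addRims l k y.1 y.2) (addRims l k x.1 x.2)
            then q l k ^ x.2 * sigma l k x.1 else 0 := by
      intro y hy
      rw [mem_termIndex hk] at hy
      rw [sigma_column_mul_sigma hl hk (hmu _) hy.1, Finset.mul_sum]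
      -- Multiplication by $q^{m}$ adds $m$ hooks to both ends of a step; targets with fewer than
      -- $m$ hooks are not reached by any step.
      refine Finset.sum_of_injOn (fun z => (z.1, y.2 + z.2)) ?_ ?_ ?_ ?_
      · intro z _ z' _ e
        simp only [Prod.mk.injEq] at e
        exact Prod.ext e.1 (by omega)
      · intro z hz
        simp only [Finset.mem_coe, mem_termIndex hk] at hz ⊢
        refine ⟨hz.1, ?_⟩
        rw [add_mul]
        omega
      · intro x hx hx'
        rw [mem_termIndex hk] at hx
        rw [if_neg]
        rw [step_addRims_iff hk hy.1 hx.1]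
        rintro ⟨hle, -⟩
        obtain ⟨d, hd⟩ := Nat.exists_eq_add_of_le hle
        refine hx' ⟨(x.1, d), ?_, Prod.ext rfl hd.symm⟩
        simp only [Finset.mem_coe, mem_termIndex hk]
        refine ⟨hx.1, ?_⟩
        have := hx.2
        rw [hd, add_mul] at this
        omega
      · intro z hz
        rw [mem_termIndex hk] at hz
        rw [step_addRims_add_iff hk hy.1.cyl hz.1.cyl, mul_ite, mul_zero, pow_add, mul_assoc]
    calc _ = sigma l k (column p) * ((∏ i : Fin r, sigma l k (column (mu i.castSucc))) *
          sigma l k lam) := by rw [Fin.prod_univ_castSucc]; ring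
      _ = ∑ y ∈ termIndex l k N,
          (count true l k lam (fun i : Fin r => mu i.castSucc) (addRims l k y.1 y.2) : Lam l k) *
            (q l k ^ y.2 * (sigma l k (column p) * sigma l k y.1)) := by
        rw [ih _ fun i => hmu _, Finset.mul_sum]
        exact Finset.sum_congr rfl fun y _ => by ring
      _ = ∑ y ∈ termIndex l k N, ∑ x ∈ termIndex l k (N + p),
          if Step true l k (addRims l k y.1 y.2) (addRims l k x.1 x.2) then
            (count true l k lam (fun i : Fin r => mu i.castSucc) (addRims l k y.1 y.2) : Lam l k) *
              q l k ^ x.2 * sigma l k x.1 else 0 := by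
        refine Finset.sum_congr rfl fun y hy => ?_
        rw [hshift y hy, Finset.mul_sum]
        exact Finset.sum_congr rfl fun x _ => by rw [mul_ite, mul_zero, mul_assoc]
      _ = _ := by
        rw [Finset.sum_comm, hNp]
        refine Finset.sum_congr rfl fun x hx => ?_
        rw [mem_termIndex hk] at hx
        rw [count_succ hk h mu (hx.1.cyl.addRims hk _)
          (by rw [hNp, hx.1.cyl.card_addRims hk, hx.2]), Nat.cast_sum, Finset.sum_mul,
          Finset.sum_mul]
        exact Finset.sum_congr rfl fun y _ => by split_ifs <;> simp

end QSchur

end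

theorem proposition4p3 (l k : ℕ) (hl : 0 < l) (hk : 0 < k) :
    (∀ (r : ℕ) (mu : Fin r → ℕ) (lam : YoungDiagram),
      QSchur.InRect l k lam → (∀ i, mu i ≤ l) →
      (∏ i, QSchur.sigma l k (QSchur.column (mu i))) * QSchur.sigma l k lam =
        ∑ x ∈ QSchur.termIndex l k (lam.card + ∑ i, mu i),
          (QSchur.conjQuantumKostka l k lam mu x.1 x.2 : QSchur.Lam l k) *
            QSchur.q l k ^ x.2 * QSchur.sigma l k x.1) ∧
    (∀ (r : ℕ) (mu : Fin r → ℕ) (lam nu : YoungDiagram) (m : ℕ),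
      QSchur.InRect l k lam → QSchur.InRect l k nu → (∀ i, mu i ≤ k) →
      lam.card + ∑ i, mu i = nu.card + m * (k + l) →
      QSchur.quantumKostka l k lam mu nu m =
        QSchur.conjQuantumKostka k l lam.transpose mu nu.transpose m) := by
  refine ⟨fun r mu lam h hmu => ?_, fun r mu lam nu m h h' _ hcard => ?_⟩
  · simp only [QSchur.conjQuantumKostka_eq_count]
    exact QSchur.prod_sigma_column_mul_sigma hl hk mu h hmu
  · rw [QSchur.quantumKostka_eq_count, QSchur.conjQuantumKostka_eq_count]
    exact QSchur.count_transpose hl hk mu h h' hcard
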